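/- Let $N,T\in\mathbb N$, let $d_b$ be a (Borel measurable) metric on $\mathbb R^N$, and let $c>0$, $\gamma>0$, $1\le p<\infty$. **Trajectories.** A trajectory is $X=(\omega,x^{1:\nu})$ with start time $1\le\omega\le T$, length $1\le\nu\le T-\omega+1$ and states $x^1,\dots,x^\nu\in\mathbb R^N$; put $\tau^k(X)=\{x^{k+1-\omega}\}$ if $\omega\le k\le\omega+\nu-1$ and $\tau^k(X)=\emptyset$ otherwise. Let $\Upsilon$ be the set of finite sets of trajectories, with the $\sigma$-algebra generated by the maps $\mathbf X\mapsto|\mathbf X\cap B|$, $B$ a Borel set of trajectories. **Metric on $\Upsilon$.** For $A,B\subset\mathbb R^N$ with at most one element let $d(\{x\},\{y\})=\min(c,d_b(x,y))$, $d(\emptyset,\emptyset)=0$ and $d(A,B)=c/2^{1/p}$ if exactly one of $A,B$ is empty. For $\mathbf X=\{X_1,\dots,X_n\}$, $\mathbf Y=\{Y_1,\dots,Y_m\}$ in $\Upsilon$ let $D^k_{\mathbf X,\mathbf Y}$ be the $(n+1)\times(m+1)$ matrix with entries $d(\tau^k(X_i),\tau^k(Y_j))^p$, where $\tau^k(X_{n+1})=\tau^k(Y_{m+1})=\emptyset$,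 and let $\overline{\mathcal W}_{\mathbf X,\mathbf Y}$ be the set of entrywise nonnegative $(n+1)\times(m+1)$ matrices $W$ with $\sum_{i=1}^{n+1}W(i,j)=1$ for $j\le m$, $\sum_{j=1}^{m+1}W(i,j)=1$ for $i\le n$ and $W(n+1,m+1)=0$. Define $$\bar d_p^{(c,\gamma)}(\mathbf X,\mathbf Y)=\min_{W^1,\dots,W^T\in\overline{\mathcal W}_{\mathbf X,\mathbf Y}}\Big(\sum_{k=1}^T\mathrm{tr}\big[(D^k_{\mathbf X,\mathbf Y})^\dagger W^k\big]+\frac{\gamma^p}{2}\sum_{k=1}^{T-1}\sum_{i=1}^{n}\sum_{j=1}^{m}|W^k(i,j)-W^{k+1}(i,j)|\Big)^{1/p}.$$ **Random sets.** Let $(\Omega,P)$ be a probability space. A random finite set of trajectories is a measurable map $\Omega\to\Upsilon$; for two of them put $$\Delta(\mathbf X,\mathbf Y)=\big(\mathbb E[\bar d_p^{(c,\gamma)}(\mathbf X,\mathbf Y)^p]\big)^{1/p}\in[0,\infty].$$ **Lemma.** For random finite sets of trajectories $\mathbf X,\mathbf Y,\mathbf Z$ on $(\Omega,P)$, $\bar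 d_p^{(c,\gamma)}(\mathbf X,\mathbf Y)$ is a random variable, and $\Delta$ is a metric on the space of random finite sets of trajectories, where almost surely equal ones are identified: $\Delta(\mathbf X,\mathbf Y)=0$ if and only if $\mathbf X=\mathbf Y$ almost surely, $\Delta(\mathbf X,\mathbf Y)=\Delta(\mathbf Y,\mathbf X)$, and $\Delta(\mathbf X,\mathbf Z)\le\Delta(\mathbf X,\mathbf Y)+\Delta(\mathbf Y,\mathbf Z)$. On the space of random finite sets of trajectories with $\mathbb E|\mathbf X|<\infty$, modulo almost sure equality, $\Delta$ is finite, so that it is a metric in the usual sense there. Moreover, if $\mathbf X,\mathbf Y$ have a joint density $\psi\colon\Upsilon\times\Upsilon\to[0,\infty]$, that is, $\psi$ is measurable and $P((\mathbf X,\mathbf Y)\in A)=\int\!\int 1_A\,\psi\;\delta\mathbf X\,\delta\mathbf Y$ for all measurable $A\subset\Upsilon\times\Upsilon$, then $$\Delta(\mathbf X,\mathbf Y)=\Big(\int\!\int\bar d_p^{(c,\gamma)}(\mathbf X,\mathbf Y)^p\,\psi(\mathbf X,\mathbf Y)\,\delta\mathbf X\,\delta\mathbf Y\Big)^{1/p}.$$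 Here the set integral is $\int f(\mathbf X)\,\delta\mathbf X=\sum_{n\ge0}\frac1{n!}\int\cdots\int f(\{X_1,\dots,X_n\})\,dX_1\cdots dX_n$ with $\int g(X)\,dX=\sum_{(\omega,\nu)}\int_{(\mathbb R^N)^\nu}g(\omega,x^{1:\nu})\,dx^{1:\nu}$, the sum being over all admissible start times and lengths. -/

import Mathlib

open MeasureTheory
open scoped ENNReal Matrix

noncomputable section

namespace TrajectoryMetric

/-- The single-target state space `ℝ^N` with its Borel structure and Lebesgue measure. -/
abbrev State (N : ℕ) : Type := EuclideanSpace ℝ (Fin N)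

/-- Pairs (start time `ω`, length `ν`) of the nonempty trajectories that live in the time interval
`1, …, T`: `1 ≤ ω ≤ T` and `1 ≤ ν ≤ T - ω + 1`. -/
abbrev TimeSpan (T : ℕ) : Type :=
  {a : ℕ × ℕ // 1 ≤ a.1 ∧ a.1 ≤ T ∧ 1 ≤ a.2 ∧ a.1 + a.2 ≤ T + 1}

/-- A trajectory `(ω, x^{1:ν})`, as an element of the disjoint union over `(ω, ν)` of `(ℝ^N)^ν`. -/
abbrev Trajectory (N T : ℕ) : Type := Σ a : TimeSpan T, (Fin a.1.2 → State N)

/-- Finite sets of trajectories. (A structure, so that it does not inherit the measurable structure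
of pointwise membership that Mathlib puts on `Finset`.) -/
@[ext]
structure TrajSet (N T : ℕ) : Type where
  elems : Finset (Trajectory N T)

/-- The state of a trajectory at time `k`; a subset of `ℝ^N` with at most one element is modelled
by `Option`, with `none` for the empty set. -/
def stateAt {N T : ℕ} (X : Trajectory N T) (k : ℕ) : Option (State N) :=
  if h : X.1.1.1 ≤ k ∧ k + 1 ≤ X.1.1.1 + X.1.1.2 then
    some (X.2 ⟨k - X.1.1.1, by omega⟩)
  else none

/-- `d` is a metric on `α`. -/
structure IsMetric {α : Type*} (d : α → α → ℝ) : Prop where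
  nonneg : ∀ x y, 0 ≤ d x y
  eq_zero_iff : ∀ x y, d x y = 0 ↔ x = y
  symm : ∀ x y, d x y = d y x
  triangle : ∀ x y z, d x z ≤ d x y + d y z

/-- The base metric on subsets of `ℝ^N` with at most one element. -/
def baseDist {N : ℕ} (db : State N → State N → ℝ) (c p : ℝ) :
    Option (State N) → Option (State N) → ℝ
  | some x, some y => min c (db x y)
  | none, none => 0
  | some _, none => c / (2 : ℝ) ^ (1 / p)
  | none, some _ => c / (2 : ℝ) ^ (1 / p)

/-- The matrix of `p`-th powers of base distances at time `k`. Rows are indexed by the trajectories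
in `X`, columns by those in `Y`; the additional index `none` stands for "unassigned". -/
def costMatrix {N T : ℕ} (db : State N → State N → ℝ) (c p : ℝ) (X Y : TrajSet N T) (k : ℕ) :
    Matrix (Option X.elems) (Option Y.elems) ℝ :=
  fun i j => baseDist db c p
    (i.bind fun x => stateAt x.1 k) (j.bind fun y => stateAt y.1 k) ^ p

/-- The relaxed (soft) assignment matrices between `X` and `Y`. -/
structure IsSoftAssignment {N T : ℕ} {X Y : TrajSet N T}
    (W : Matrix (Option X.elems) (Option Y.elems) ℝ) : Prop where
  col_sum : ∀ j : Y.elems, ∑ i, W i (some j) = 1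
  row_sum : ∀ i : X.elems, ∑ j, W (some i) j = 1
  corner : W none none = 0
  nonneg : ∀ i j, 0 ≤ W i j

/-- Localization, miss and false-target costs plus switching costs of the assignment matrices
`W 1, …, W T`; the values of `W` at other times play no role. -/
def totalCost {N T : ℕ} (db : State N → State N → ℝ) (c γ p : ℝ) (X Y : TrajSet N T)
    (W : ℕ → Matrix (Option X.elems) (Option Y.elems) ℝ) : ℝ :=
  ∑ k ∈ Finset.Icc 1 T, Matrix.trace ((costMatrix db c p X Y k)ᵀ * W k) +
    γ ^ p / 2 * ∑ k ∈ Finset.Icc 1 (T - 1), ∑ i : X.elems, ∑ j : Y.elems,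
      |W k (some i) (some j) - W (k + 1) (some i) (some j)|

/-- The values over which the LP relaxation metric minimizes. -/
def lpValues {N T : ℕ} (db : State N → State N → ℝ) (c γ p : ℝ) (X Y : TrajSet N T) : Set ℝ :=
  {r | ∃ W : ℕ → Matrix (Option X.elems) (Option Y.elems) ℝ,
    (∀ k, IsSoftAssignment (W k)) ∧ r = totalCost db c γ p X Y W ^ (1 / p)}

/-- The LP relaxation metric between finite sets of trajectories. The infimum is a minimum, see
`lpDist_isLeast`. -/
def lpDist {N T : ℕ} (db : State N → State N → ℝ) (c γ p : ℝ) (X Y : TrajSet N T) : ℝ :=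
  sInf (lpValues db c γ p X Y)

theorem isCompact_softAssignment {N T : ℕ} (X Y : TrajSet N T) :
    IsCompact {W : Matrix (Option X.elems) (Option Y.elems) ℝ | IsSoftAssignment W} := by
  have hsub : {W : Matrix (Option X.elems) (Option Y.elems) ℝ | IsSoftAssignment W} =
      {W | (∀ i j, W i j ∈ Set.Icc (0 : ℝ) 1)} ∩
      ({W | ∀ j : Y.elems, ∑ i, W i (some j) = 1} ∩ ({W | ∀ i : X.elems, ∑ j, W (some i) j = 1} ∩
        {W | W none none = 0})) := by
    ext W
    constructor
    · intro h
      refine ⟨fun i j => ⟨h.nonneg i j, ?_⟩, h.col_sum, h.row_sum, h.corner⟩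
      rcases j with _ | j
      · rcases i with _ | i
        · rw [h.corner]; exact zero_le_one
        · rw [← h.row_sum i]
          exact Finset.single_le_sum (f := fun j => W (some i) j)
            (fun j _ => h.nonneg _ _) (Finset.mem_univ _)
      · rw [← h.col_sum j]
        exact Finset.single_le_sum (f := fun i => W i (some j))
          (fun i _ => h.nonneg _ _) (Finset.mem_univ _)
    · rintro ⟨h1, h2, h3, h4⟩
      exact ⟨h2, h3, h4, fun i j => (h1 i j).1⟩
  rw [hsub]
  refine IsCompact.inter_right ?_ ?_
  · have : {W : Matrix (Option X.elems) (Option Y.elems) ℝ | ∀ i j, W i j ∈ Set.Icc (0 : ℝ) 1} =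
        Set.pi Set.univ fun _ => Set.pi Set.univ fun _ => Set.Icc (0 : ℝ) 1 := by
      ext W
      exact ⟨fun h i _ j _ => h i j, fun h i j => h i trivial j trivial⟩
    rw [this]
    exact isCompact_univ_pi fun _ => isCompact_univ_pi fun _ => isCompact_Icc
  · refine IsClosed.inter ?_ (IsClosed.inter ?_ ?_)
    · simp only [Set.ofPred_forall]
      exact isClosed_iInter fun j => isClosed_eq
        (continuous_finsetSum _ fun i _ => continuous_id.matrix_elem _ _) continuous_const
    · simp only [Set.ofPred_forall]
      exact isClosed_iInter fun i => isClosed_eq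
        (continuous_finsetSum _ fun j _ => continuous_id.matrix_elem _ _) continuous_const
    · exact isClosed_eq (continuous_id.matrix_elem _ _) continuous_const

theorem exists_softAssignment {N T : ℕ} (X Y : TrajSet N T) :
    ∃ W : Matrix (Option X.elems) (Option Y.elems) ℝ, IsSoftAssignment W := by
  refine ⟨fun i j => match i, j with
    | some _, none => 1
    | none, some _ => 1
    | _, _ => 0, ?_, ?_, rfl, ?_⟩
  · intro j; simp [Fintype.sum_option]
  · intro i; simp [Fintype.sum_option]
  · intro i j
    rcases i with _ | i <;> rcases j with _ | j <;> simp

/-- The minimum that defines the LP relaxation metric is attained. -/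
theorem lpDist_isLeast {N T : ℕ} (db : State N → State N → ℝ) (c γ p : ℝ) (hp : 0 < p)
    (X Y : TrajSet N T) : IsLeast (lpValues db c γ p X Y) (lpDist db c γ p X Y) := by
  obtain ⟨W₀, hW₀⟩ := exists_softAssignment X Y
  have hK : IsCompact {W : ℕ → Matrix (Option X.elems) (Option Y.elems) ℝ | ∀ k, IsSoftAssignment (W k)} := by
    have := isCompact_univ_pi (fun _ : ℕ => isCompact_softAssignment X Y)
    convert this using 1
    ext W
    exact ⟨fun h k _ => h k, fun h k => h k trivial⟩
  have hcont : Continuous fun W : ℕ → Matrix (Option X.elems) (Option Y.elems) ℝ =>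
      totalCost db c γ p X Y W ^ (1 / p) := by
    refine Continuous.rpow_const ?_ fun _ => Or.inr (by positivity)
    unfold totalCost
    refine Continuous.add ?_ (continuous_const.mul ?_)
    · exact continuous_finsetSum _ fun k _ =>
        (continuous_const.matrix_mul (continuous_apply k)).matrix_trace
    · refine continuous_finsetSum _ fun k _ => continuous_finsetSum _ fun i _ =>
        continuous_finsetSum _ fun j _ => ?_
      exact (((continuous_apply k).matrix_elem _ _).sub
        ((continuous_apply (k + 1)).matrix_elem _ _)).abs
  have hne : (lpValues db c γ p X Y).Nonempty := ⟨_, fun _ => W₀, fun _ => hW₀, rfl⟩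
  have hc : IsCompact (lpValues db c γ p X Y) := by
    have := hK.image hcont
    convert this using 1
    ext r
    constructor
    · rintro ⟨W, hW, rfl⟩; exact ⟨W, hW, rfl⟩
    · rintro ⟨W, hW, rfl⟩; exact ⟨W, hW, rfl⟩
  exact hc.isLeast_sInf hne

/-- The σ-algebra on finite sets of trajectories: the one generated by the counting maps
`X ↦ |X ∩ B|`, with `B` a Borel set of trajectories. -/
instance instMeasurableSpaceTrajSet (N T : ℕ) : MeasurableSpace (TrajSet N T) :=
  ⨆ B : {B : Set (Trajectory N T) // MeasurableSet B},
    MeasurableSpace.comap (fun X : TrajSet N T => ((X.elems : Set (Trajectory N T)) ∩ B.1).ncard) ⊤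

/-- A random finite set of trajectories on the probability space `(Ω, P)`. -/
structure RandomTrajSet (N T : ℕ) {Ω : Type*} [MeasurableSpace Ω] (P : Measure Ω) where
  toFun : Ω → TrajSet N T
  measurable_toFun : Measurable toFun

instance {N T : ℕ} {Ω : Type*} [MeasurableSpace Ω] (P : Measure Ω) :
    CoeFun (RandomTrajSet N T P) fun _ => Ω → TrajSet N T :=
  ⟨RandomTrajSet.toFun⟩

/-- The expected number of trajectories is finite. -/
def HasFiniteMean {N T : ℕ} {Ω : Type*} [MeasurableSpace Ω] {P : Measure Ω}
    (X : RandomTrajSet N T P) : Prop :=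
  ∫⁻ ω, ((X ω).elems.card : ℝ≥0∞) ∂P < ∞

/-- Almost sure equality of random finite sets with finite expected cardinality. -/
def aeSetoid (N T : ℕ) {Ω : Type*} [MeasurableSpace Ω] (P : Measure Ω) :
    Setoid {X : RandomTrajSet N T P // HasFiniteMean X} where
  r X Y := ∀ᵐ ω ∂P, X.1 ω = Y.1 ω
  iseqv :=
    { refl := fun _ => Filter.Eventually.of_forall fun _ => rfl
      symm := fun h => h.mono fun _ hω => hω.symm
      trans := fun h h' => by filter_upwards [h, h'] with ω h1 h2 using h1.trans h2 }

/-- The space of random finite sets of trajectories on `(Ω, P)` with finite expected cardinality,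
modulo almost sure equality. -/
def RandomTrajSpace (N T : ℕ) {Ω : Type*} [MeasurableSpace Ω] (P : Measure Ω) : Type _ :=
  Quotient (aeSetoid N T P)

/-- The class of a random finite set of trajectories. -/
def RandomTrajSpace.mk {N T : ℕ} {Ω : Type*} [MeasurableSpace Ω] {P : Measure Ω}
    (X : RandomTrajSet N T P) (hX : HasFiniteMean X) : RandomTrajSpace N T P :=
  Quotient.mk (aeSetoid N T P) ⟨X, hX⟩

/-- `(E[d(X, Y)^p])^{1/p}` for the LP relaxation metric `d`, as a number in `[0, ∞]`. -/
def meanDist {N T : ℕ} {Ω : Type*} [MeasurableSpace Ω] {P : Measure Ω}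
    (db : State N → State N → ℝ) (c γ p : ℝ) (X Y : RandomTrajSet N T P) : ℝ≥0∞ :=
  (∫⁻ ω, ENNReal.ofReal (lpDist db c γ p (X ω) (Y ω) ^ p) ∂P) ^ (1 / p)

/-- The reference measure on single trajectories: integrating against it is summation over start
times and lengths and Lebesgue integration over the states. -/
def trajMeasure (N T : ℕ) : Measure (Trajectory N T) :=
  Measure.sum fun a : TimeSpan T => (volume : Measure (Fin a.1.2 → State N)).map (Sigma.mk a)

open scoped Classical in
/-- The set integral
`∫ f(X) δX = ∑ₙ (1 / n!) ∫ f({X₁, …, Xₙ}) dX₁ ⋯ dXₙ` over finite sets of trajectories. -/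
def setIntegral {N T : ℕ} (f : TrajSet N T → ℝ≥0∞) : ℝ≥0∞ :=
  ∑' n : ℕ, ((n.factorial : ℝ≥0∞))⁻¹ *
    ∫⁻ x : Fin n → Trajectory N T, f ⟨Finset.univ.image x⟩
      ∂(Measure.pi fun _ : Fin n => trajMeasure N T)

/-- `ψ` is a joint (multi-object) probability density of `X` and `Y`: probabilities of events
about `(X, Y)` are set integrals of `ψ`. -/
structure IsJointDensity {N T : ℕ} {Ω : Type*} [MeasurableSpace Ω] {P : Measure Ω}
    (X Y : RandomTrajSet N T P) (ψ : TrajSet N T × TrajSet N T → ℝ≥0∞) : Prop where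
  measurable : Measurable ψ
  prob_eq : ∀ A : Set (TrajSet N T × TrajSet N T), MeasurableSet A →
    P {ω | (X ω, Y ω) ∈ A} =
      setIntegral fun y => setIntegral fun x => A.indicator ψ (x, y)

end TrajectoryMetric

end

open MeasureTheory
open scoped ENNReal Matrix

noncomputable section

namespace TrajectoryMetric

/-! ### The base distance -/

variable {N T : ℕ} {db : State N → State N → ℝ} {c γ p : ℝ}

/-! For fixed sets the LP distance is itself a metric, and `meanDist` is the L^p(P) seminorm of this
distance. Its metric axioms thus follow from the pointwise ones, Minkowski's inequality on Ω, and
the fact that a nonnegative function with zero integral vanishes almost surely. Finiteness comes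
from leaving every trajectory unassigned: `lpDist ^ p` is at most a constant times the sum of the
two cardinalities.

The pointwise triangle inequality (`lpDist_triangle`) is a gluing argument as for Wasserstein
distances. Optimal assignments from X to Y and from Y to Z are glued at each time into weights on
triples, whose marginals are the given assignments up to the pair of unassigned indices, where the
cost is zero. Weighted Minkowski over times and triples handles the location cost. The switching
cost is subadditive because the matched part of the composition is a product of substochastic
matrices. For definiteness (`subset_of_lpDist_eq_zero`), zero switching cost freezes the matching in
time, and zero location cost then makes matched trajectories equal.

Measurability (`measurable_lpDist`) needs work because the index types of the matrices depend on the
sets. On sets of given cardinalities a measurable enumeration moves the minimization to a fixed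
compact set, where the minimum is continuous in the costs. The density formula holds because the set
integral is integration against an s-finite measure, so Tonelli's theorem applies and the law of (X,
Y) has density ψ. -/

theorem two_rpow_one_div_le_two (hp : 1 ≤ p) : (2 : ℝ) ^ (1 / p) ≤ 2 := by
  calc (2 : ℝ) ^ (1 / p) ≤ (2 : ℝ) ^ (1 : ℝ) := by
        apply Real.rpow_le_rpow_of_exponent_le (by norm_num)
        rw [div_le_one (by linarith)]; exact hp
    _ = 2 := Real.rpow_one 2

theorem half_le_missDist (hc : 0 < c) (hp : 1 ≤ p) : c / 2 ≤ c / (2 : ℝ) ^ (1 / p) :=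
  div_le_div_of_nonneg_left hc.le (by positivity) (two_rpow_one_div_le_two hp)

theorem missDist_pos (hc : 0 < c) : 0 < c / (2 : ℝ) ^ (1 / p) := by positivity

theorem baseDist_nonneg (hdb : IsMetric db) (hc : 0 < c) (a b : Option (State N)) :
    0 ≤ baseDist db c p a b := by
  have := missDist_pos (p := p) hc
  rcases a with _ | x <;> rcases b with _ | y <;> simp only [baseDist]
  · exact le_rfl
  · exact this.le
  · exact this.le
  · exact le_min hc.le (hdb.nonneg x y)

theorem baseDist_eq_zero_iff (hdb : IsMetric db) (hc : 0 < c) (a b : Option (State N)) :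
    baseDist db c p a b = 0 ↔ a = b := by
  have := (missDist_pos (p := p) hc).ne'
  rcases a with _ | x <;> rcases b with _ | y <;> simp only [baseDist]
  · simp only [reduceCtorEq, iff_false]; exact this
  · simp only [reduceCtorEq, iff_false]; exact this
  · rw [Option.some.injEq, ← hdb.eq_zero_iff]
    constructor
    · intro h
      rcases min_choice c (db x y) with h' | h' <;> linarith
    · intro h
      rw [h, min_eq_right hc.le]

theorem baseDist_comm (hdb : IsMetric db) (a b : Option (State N)) :
    baseDist db c p a b = baseDist db c p b a := by
  rcases a with _ | x <;> rcases b with _ | y <;> simp only [baseDist]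
  rw [hdb.symm]

/-- A detour through the empty set costs twice the miss distance, which is at least `c` because `p ≥
1`; the cutoff at `c` covers this case. -/
theorem baseDist_triangle (hdb : IsMetric db) (hc : 0 < c) (hp : 1 ≤ p)
    (a b d : Option (State N)) :
    baseDist db c p a d ≤ baseDist db c p a b + baseDist db c p b d := by
  have h1 := missDist_pos (p := p) hc
  have h2 := half_le_missDist hc hp
  rcases a with _ | x <;> rcases b with _ | y <;> rcases d with _ | z <;> simp only [baseDist]
  · simp
  · simp
  · positivity
  · linarith [le_min hc.le (hdb.nonneg y z)]
  · simp
  · linarith [min_le_left c (db x z)]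
  · linarith [le_min hc.le (hdb.nonneg x y)]
  · have h3 := hdb.triangle x y z
    have h4 := hdb.nonneg x y
    have h5 := hdb.nonneg y z
    have h6 := min_le_left c (db x z)
    have h7 := min_le_right c (db x z)
    rcases min_choice c (db x y) with h | h <;> rcases min_choice c (db y z) with h' | h' <;>
      rw [h, h'] <;> linarith

/-! ### Location cost and switching cost -/

/-- The state at time `k` of a trajectory of `X`, or the empty set for the unassigned index. -/
def optState {X : TrajSet N T} (k : ℕ) (i : Option X.elems) : Option (State N) :=
  i.bind fun x => stateAt x.1 k

@[simp] theorem optState_none {X : TrajSet N T} (k : ℕ) :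
    optState k (none : Option X.elems) = none := rfl

/-- The localization, miss and false-target part of the total cost. -/
def locCost (db : State N → State N → ℝ) (c p : ℝ) (X Y : TrajSet N T)
    (W : ℕ → Matrix (Option X.elems) (Option Y.elems) ℝ) : ℝ :=
  ∑ k ∈ Finset.Icc 1 T, ∑ i, ∑ j, baseDist db c p (optState k i) (optState k j) ^ p * W k i j

/-- The total variation over time of the assignments of pairs of trajectories. -/
def switchCost (X Y : TrajSet N T) (W : ℕ → Matrix (Option X.elems) (Option Y.elems) ℝ) : ℝ :=
  ∑ k ∈ Finset.Icc 1 (T - 1), ∑ i : X.elems, ∑ j : Y.elems,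
    |W k (some i) (some j) - W (k + 1) (some i) (some j)|

theorem totalCost_eq (X Y : TrajSet N T)
    (W : ℕ → Matrix (Option X.elems) (Option Y.elems) ℝ) :
    totalCost db c γ p X Y W = locCost db c p X Y W + γ ^ p / 2 * switchCost X Y W := by
  unfold totalCost locCost switchCost
  congr 1
  refine Finset.sum_congr rfl fun k _ => ?_
  rw [Finset.sum_comm]
  simp only [Matrix.trace, Matrix.diag, Matrix.mul_apply, Matrix.transpose_apply]
  rfl

theorem locCost_nonneg (hdb : IsMetric db) (hc : 0 < c) {X Y : TrajSet N T}
    {W : ℕ → Matrix (Option X.elems) (Option Y.elems) ℝ} (hW : ∀ k, IsSoftAssignment (W k)) :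
    0 ≤ locCost db c p X Y W :=
  Finset.sum_nonneg fun k _ => Finset.sum_nonneg fun i _ => Finset.sum_nonneg fun j _ =>
    mul_nonneg (Real.rpow_nonneg (baseDist_nonneg hdb hc _ _) _) ((hW k).nonneg i j)

theorem switchCost_nonneg {X Y : TrajSet N T}
    (W : ℕ → Matrix (Option X.elems) (Option Y.elems) ℝ) : 0 ≤ switchCost X Y W :=
  Finset.sum_nonneg fun _ _ => Finset.sum_nonneg fun _ _ => Finset.sum_nonneg fun _ _ =>
    abs_nonneg _

theorem totalCost_nonneg (hdb : IsMetric db) (hc : 0 < c) (hγ : 0 < γ) {X Y : TrajSet N T}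
    {W : ℕ → Matrix (Option X.elems) (Option Y.elems) ℝ} (hW : ∀ k, IsSoftAssignment (W k)) :
    0 ≤ totalCost db c γ p X Y W := by
  rw [totalCost_eq]
  have := locCost_nonneg (p := p) hdb hc hW
  have := switchCost_nonneg W
  positivity

theorem lpDist_nonneg (hdb : IsMetric db) (hc : 0 < c) (hγ : 0 < γ) (X Y : TrajSet N T) :
    0 ≤ lpDist db c γ p X Y := by
  apply Real.sInf_nonneg
  rintro r ⟨W, hW, rfl⟩
  exact Real.rpow_nonneg (totalCost_nonneg hdb hc hγ hW) _

theorem lpDist_le (hp : 1 ≤ p) {X Y : TrajSet N T}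
    {W : ℕ → Matrix (Option X.elems) (Option Y.elems) ℝ} (hW : ∀ k, IsSoftAssignment (W k)) :
    lpDist db c γ p X Y ≤ totalCost db c γ p X Y W ^ (1 / p) :=
  (lpDist_isLeast db c γ p (by linarith) X Y).2 ⟨W, hW, rfl⟩

theorem exists_lpDist_eq (hp : 1 ≤ p) (X Y : TrajSet N T) :
    ∃ W : ℕ → Matrix (Option X.elems) (Option Y.elems) ℝ,
      (∀ k, IsSoftAssignment (W k)) ∧ lpDist db c γ p X Y = totalCost db c γ p X Y W ^ (1 / p) :=
  (lpDist_isLeast db c γ p (by linarith) X Y).1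

theorem lpDist_rpow_le (hdb : IsMetric db) (hc : 0 < c) (hγ : 0 < γ) (hp : 1 ≤ p)
    {X Y : TrajSet N T} {W : ℕ → Matrix (Option X.elems) (Option Y.elems) ℝ}
    (hW : ∀ k, IsSoftAssignment (W k)) :
    lpDist db c γ p X Y ^ p ≤ totalCost db c γ p X Y W := by
  have h := Real.rpow_le_rpow (lpDist_nonneg hdb hc hγ X Y) (lpDist_le (db := db) (c := c)
    (γ := γ) hp hW) (by linarith : 0 ≤ p)
  rwa [← Real.rpow_mul (totalCost_nonneg hdb hc hγ hW), one_div_mul_cancel (by linarith),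
    Real.rpow_one] at h

/-! ### Symmetry -/

theorem IsSoftAssignment.transpose {X Y : TrajSet N T}
    {W : Matrix (Option X.elems) (Option Y.elems) ℝ} (hW : IsSoftAssignment W) :
    IsSoftAssignment Wᵀ where
  col_sum := hW.row_sum
  row_sum := hW.col_sum
  corner := hW.corner
  nonneg i j := hW.nonneg j i

theorem totalCost_transpose (hdb : IsMetric db) {X Y : TrajSet N T}
    (W : ℕ → Matrix (Option X.elems) (Option Y.elems) ℝ) :
    totalCost db c γ p Y X (fun k => (W k)ᵀ) = totalCost db c γ p X Y W := by
  rw [totalCost_eq, totalCost_eq]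
  unfold locCost switchCost
  congr 1
  · refine Finset.sum_congr rfl fun k _ => ?_
    rw [Finset.sum_comm]
    refine Finset.sum_congr rfl fun i _ => Finset.sum_congr rfl fun j _ => ?_
    rw [baseDist_comm hdb]
    rfl
  · congr 1
    refine Finset.sum_congr rfl fun k _ => ?_
    rw [Finset.sum_comm]
    simp only [Matrix.transpose_apply]

theorem lpDist_comm (hdb : IsMetric db) (hp : 1 ≤ p) (X Y : TrajSet N T) :
    lpDist db c γ p X Y = lpDist db c γ p Y X := by
  have key : ∀ X Y : TrajSet N T, lpDist db c γ p X Y ≤ lpDist db c γ p Y X := by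
    intro X Y
    obtain ⟨W, hW, h⟩ := exists_lpDist_eq (db := db) (c := c) (γ := γ) hp Y X
    rw [h, ← totalCost_transpose hdb]
    exact lpDist_le hp fun k => (hW k).transpose
  exact le_antisymm (key X Y) (key Y X)

/-! ### Definiteness -/

theorem stateAt_isSome_iff (X : Trajectory N T) (k : ℕ) :
    (stateAt X k).isSome ↔ X.1.1.1 ≤ k ∧ k + 1 ≤ X.1.1.1 + X.1.1.2 := by
  unfold stateAt
  split_ifs with h
  · simp [h]
  · simpa only [Option.isSome_none, Bool.false_eq_true, false_iff] using h

/-- The set of times at which a state exists determines start and length; the states are then read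
off one by one. -/
theorem trajectory_ext {X Y : Trajectory N T}
    (h : ∀ k ∈ Finset.Icc 1 T, stateAt X k = stateAt Y k) : X = Y := by
  obtain ⟨⟨⟨a, l⟩, ha1, ha2, ha3, ha4⟩, x⟩ := X
  obtain ⟨⟨⟨b, m⟩, hb1, hb2, hb3, hb4⟩, y⟩ := Y
  simp only at ha1 ha2 ha3 ha4 hb1 hb2 hb3 hb4 x y
  have hs : ∀ k, 1 ≤ k → k ≤ T → ((a ≤ k ∧ k + 1 ≤ a + l) ↔ (b ≤ k ∧ k + 1 ≤ b + m)) := by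
    intro k h1 h2
    have := congrArg (fun o => o.isSome = true) (h k (Finset.mem_Icc.2 ⟨h1, h2⟩))
    simp only [stateAt_isSome_iff, eq_iff_iff] at this
    exact this
  -- Comparing the two intervals at their first and last times suffices to identify them.
  have e1 := hs a (by omega) (by omega)
  have e2 := hs b (by omega) (by omega)
  have e3 := hs (a + l - 1) (by omega) (by omega)
  have e4 := hs (b + m - 1) (by omega) (by omega)
  obtain rfl : a = b := by omega
  obtain rfl : l = m := by omega
  congr 1
  funext i
  have h2 := h (a + i) (Finset.mem_Icc.2 ⟨by omega, by have := i.2; omega⟩)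
  have hi : a ≤ a + i.1 ∧ a + i.1 + 1 ≤ a + l := ⟨by omega, by have := i.2; omega⟩
  simp only [stateAt, hi, and_self, dif_pos, Option.some.injEq] at h2
  convert h2 using 2 <;> exact Fin.ext (by simp)

theorem lpDist_self (hdb : IsMetric db) (hc : 0 < c) (hγ : 0 < γ) (hp : 1 ≤ p)
    (X : TrajSet N T) : lpDist db c γ p X X = 0 := by
  classical
  refine le_antisymm ?_ (lpDist_nonneg hdb hc hγ X X)
  -- The identity matching; excluding `none` keeps the corner entry zero.
  let W : Matrix (Option X.elems) (Option X.elems) ℝ :=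
    fun i j => if i = j ∧ i ≠ none then 1 else 0
  have hW : IsSoftAssignment W := by
    refine ⟨fun j => ?_, fun i => ?_, by simp [W], fun i j => ?_⟩
    · exact (Finset.sum_eq_single (some j) (fun b _ hb => by simp [W, hb]) (by simp)).trans
        (by simp [W])
    · simp [W]
    · simp only [W]; split_ifs <;> norm_num
  refine (lpDist_le hp fun _ => hW).trans_eq ?_
  rw [totalCost_eq]
  have h1 : locCost db c p X X (fun _ => W) = 0 := by
    refine Finset.sum_eq_zero fun k _ => Finset.sum_eq_zero fun i _ => Finset.sum_eq_zero
      fun j _ => ?_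
    by_cases hij : i = j
    · subst hij
      rw [(baseDist_eq_zero_iff hdb hc _ _).2 rfl, Real.zero_rpow (by linarith), zero_mul]
    · simp [W, hij]
  rw [h1]
  simp only [switchCost, sub_self, abs_zero, Finset.sum_const_zero, mul_zero, add_zero]
  exact Real.zero_rpow (one_div_ne_zero (by linarith))

/-- Both parts of an optimal cost vanish. As `γ > 0`, the weights between trajectories are constant
in time, and positive weight joins only equal states. At its start time x cannot be unassigned, so
it has positive weight with some y, hence at all times, and x = y. -/
theorem subset_of_lpDist_eq_zero (hdb : IsMetric db) (hc : 0 < c) (hγ : 0 < γ) (hp : 1 ≤ p)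
    {X Y : TrajSet N T} (h : lpDist db c γ p X Y = 0) : X.elems ⊆ Y.elems := by
  obtain ⟨W, hW, h'⟩ := exists_lpDist_eq (db := db) (c := c) (γ := γ) hp X Y
  rw [h, eq_comm, Real.rpow_eq_zero (totalCost_nonneg hdb hc hγ hW) (by
    exact one_div_ne_zero (by linarith)), totalCost_eq] at h'
  have hl := locCost_nonneg (p := p) hdb hc hW
  have hs := switchCost_nonneg W
  have hg : 0 < γ ^ p / 2 := by positivity
  have hs0 : switchCost X Y W = 0 := by
    have : γ ^ p / 2 * switchCost X Y W = 0 := by nlinarith [mul_nonneg hg.le hs]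
    exact (mul_eq_zero.1 this).resolve_left hg.ne'
  have hl0 : locCost db c p X Y W = 0 := by nlinarith [mul_nonneg hg.le hs]
  have hloc : ∀ k ∈ Finset.Icc 1 T, ∀ i j, W k i j ≠ 0 → optState k i = optState k j := by
    intro k hk i j hij
    have hn : ∀ k i j, 0 ≤ baseDist db c p (optState k i) (optState k j) ^ p * W k i j :=
      fun k i j => mul_nonneg (Real.rpow_nonneg (baseDist_nonneg hdb hc _ _) _)
        ((hW k).nonneg i j)
    have h1 := (Finset.sum_eq_zero_iff_of_nonneg fun k _ => Finset.sum_nonneg fun i _ =>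
      Finset.sum_nonneg fun j _ => hn k i j).1 hl0 k hk
    have h2 := (Finset.sum_eq_zero_iff_of_nonneg fun i _ =>
      Finset.sum_nonneg fun j _ => hn k i j).1 h1 i (Finset.mem_univ _)
    have h3 := (Finset.sum_eq_zero_iff_of_nonneg fun j _ => hn k i j).1 h2 j (Finset.mem_univ _)
    have h4 := (mul_eq_zero.1 h3).resolve_right hij
    rw [Real.rpow_eq_zero (baseDist_nonneg hdb hc _ _) (by linarith)] at h4
    exact (baseDist_eq_zero_iff hdb hc _ _).1 h4
  have hconst : ∀ k ∈ Finset.Icc 1 T, ∀ (i : X.elems) (j : Y.elems),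
      W k (some i) (some j) = W 1 (some i) (some j) := by
    intro k hk i j
    obtain ⟨hk1, hk2⟩ := Finset.mem_Icc.1 hk
    clear hk
    induction k, hk1 using Nat.le_induction with
    | base => rfl
    | succ k hk ih =>
      rw [← ih (by omega)]
      have h1 := (Finset.sum_eq_zero_iff_of_nonneg fun k _ => Finset.sum_nonneg fun i _ =>
        Finset.sum_nonneg fun j _ => abs_nonneg _).1 hs0 k (Finset.mem_Icc.2 ⟨hk, by omega⟩)
      have h2 := (Finset.sum_eq_zero_iff_of_nonneg fun i _ =>
        Finset.sum_nonneg fun j _ => abs_nonneg _).1 h1 i (Finset.mem_univ _)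
      have h3 := (Finset.sum_eq_zero_iff_of_nonneg fun j _ => abs_nonneg _).1 h2 j
        (Finset.mem_univ _)
      linarith [abs_eq_zero.1 h3]
  intro x hx
  have hrow : ∀ k, W k (some ⟨x, hx⟩) none + ∑ j : Y.elems, W k (some ⟨x, hx⟩) (some j) = 1 :=
    fun k => by rw [← Fintype.sum_option]; exact (hW k).row_sum ⟨x, hx⟩
  -- The start time of x, where its state is certainly nonempty.
  have hω : x.1.1.1 ∈ Finset.Icc 1 T := Finset.mem_Icc.2 ⟨x.1.2.1, x.1.2.2.1⟩
  have hnone : W x.1.1.1 (some ⟨x, hx⟩) none = 0 := by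
    by_contra hne
    have h1 := hloc _ hω _ _ hne
    have h2 : (stateAt x x.1.1.1).isSome := by
      rw [stateAt_isSome_iff]
      exact ⟨le_rfl, by have := x.1.2.2.2.1; omega⟩
    change stateAt x x.1.1.1 = none at h1
    simp [h1] at h2
  obtain ⟨y, hy⟩ : ∃ y : Y.elems, W 1 (some ⟨x, hx⟩) (some y) ≠ 0 := by
    by_contra! hall
    have := hrow x.1.1.1
    rw [hnone, Finset.sum_eq_zero fun j _ => (hconst _ hω _ j).trans (hall j)] at this
    norm_num at this
  have hxy : x = y.1 := trajectory_ext fun k hk =>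
    hloc k hk (some ⟨x, hx⟩) (some y) (by rwa [hconst k hk])
  rw [hxy]
  exact y.2

theorem lpDist_eq_zero_iff (hdb : IsMetric db) (hc : 0 < c) (hγ : 0 < γ) (hp : 1 ≤ p)
    (X Y : TrajSet N T) : lpDist db c γ p X Y = 0 ↔ X = Y := by
  constructor
  · intro h
    exact TrajSet.ext ((subset_of_lpDist_eq_zero hdb hc hγ hp h).antisymm
      (subset_of_lpDist_eq_zero hdb hc hγ hp ((lpDist_comm hdb hp Y X).trans h)))
  · rintro rfl
    exact lpDist_self hdb hc hγ hp X

/-! ### Upper bound -/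

/-- Leaving everything unassigned at all times incurs no switching cost and at most one miss cost
per trajectory and time. -/
theorem lpDist_rpow_le_card (hdb : IsMetric db) (hc : 0 < c) (hγ : 0 < γ) (hp : 1 ≤ p)
    (X Y : TrajSet N T) :
    lpDist db c γ p X Y ^ p ≤
      T * (c / (2 : ℝ) ^ (1 / p)) ^ p * (X.elems.card + Y.elems.card) := by
  let W : Matrix (Option X.elems) (Option Y.elems) ℝ := fun i j => match i, j with
    | some _, none => 1
    | none, some _ => 1
    | _, _ => 0
  have hW : IsSoftAssignment W := by
    refine ⟨fun j => ?_, fun i => ?_, rfl, fun i j => ?_⟩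
    · simp [Fintype.sum_option, W]
    · simp [Fintype.sum_option, W]
    · rcases i with _ | i <;> rcases j with _ | j <;> simp [W]
  refine (lpDist_rpow_le hdb hc hγ hp fun _ => hW).trans ?_
  have hm := missDist_pos (p := p) hc
  have hle : ∀ a, baseDist db c p a none ^ p ≤ (c / (2 : ℝ) ^ (1 / p)) ^ p := by
    intro a
    refine Real.rpow_le_rpow (baseDist_nonneg hdb hc _ _) ?_ (by linarith)
    rcases a with _ | a
    · exact hm.le
    · exact le_rfl
  have hle' : ∀ a, baseDist db c p none a ^ p ≤ (c / (2 : ℝ) ^ (1 / p)) ^ p := by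
    intro a
    rw [baseDist_comm hdb]
    exact hle a
  rw [totalCost_eq]
  simp only [switchCost, sub_self, abs_zero, Finset.sum_const_zero, mul_zero, add_zero, locCost]
  calc _ ≤ ∑ k ∈ Finset.Icc 1 T, (c / (2 : ℝ) ^ (1 / p)) ^ p * (X.elems.card + Y.elems.card) := by
        refine Finset.sum_le_sum fun k _ => ?_
        simp only [Fintype.sum_option, W, mul_zero, mul_one, zero_add, Finset.sum_const_zero,
          add_zero, optState_none]
        rw [mul_add, add_comm]
        refine add_le_add ?_ ?_
        · refine (Finset.sum_le_card_nsmul _ _ _ fun i _ => hle _).trans_eq ?_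
          simp [mul_comm]
        · refine (Finset.sum_le_card_nsmul _ _ _ fun i _ => hle' _).trans_eq ?_
          simp [mul_comm]
    _ = _ := by simp [mul_assoc]

/-! ### The triangle inequality -/

/-- The weight is absorbed as a factor `w ^ (1 / p)` of each function, which reduces to the
unweighted inequality. -/
theorem weighted_minkowski {α : Type*} (s : Finset α) {w f g h : α → ℝ} (hp : 1 ≤ p)
    (hw : ∀ a, 0 ≤ w a) (hf : ∀ a, 0 ≤ f a) (hg : ∀ a, 0 ≤ g a) (hh : ∀ a, 0 ≤ h a)
    (hle : ∀ a, h a ≤ f a + g a) :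
    (∑ a ∈ s, h a ^ p * w a) ^ (1 / p) ≤
      (∑ a ∈ s, f a ^ p * w a) ^ (1 / p) + (∑ a ∈ s, g a ^ p * w a) ^ (1 / p) := by
  have hp0 : 0 < p := by linarith
  have hr : ∀ a, 0 ≤ w a ^ (1 / p) := fun a => Real.rpow_nonneg (hw a) _
  have key : ∀ (q : α → ℝ), (∀ a, 0 ≤ q a) → ∀ a, q a ^ p * w a = (q a * w a ^ (1 / p)) ^ p := by
    intro q hq a
    rw [Real.mul_rpow (hq a) (hr a), ← Real.rpow_mul (hw a), one_div_mul_cancel hp0.ne',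
      Real.rpow_one]
  simp only [key h hh, key f hf, key g hg]
  refine le_trans ?_ (Real.Lp_add_le_of_nonneg s hp (fun a _ => mul_nonneg (hf a) (hr a))
    (fun a _ => mul_nonneg (hg a) (hr a)))
  refine Real.rpow_le_rpow (Finset.sum_nonneg fun a _ => Real.rpow_nonneg
    (mul_nonneg (hh a) (hr a)) _) (Finset.sum_le_sum fun a _ => ?_) (by positivity)
  refine Real.rpow_le_rpow (mul_nonneg (hh a) (hr a)) ?_ hp0.le
  rw [← add_mul]
  exact mul_le_mul_of_nonneg_right (hle a) (hr a)

/-- If `a^{1/p}` and `s` are both subadditive, then so is `(a + s)^{1/p}`. -/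
theorem rpow_add_le_of_subadditive (hp : 1 ≤ p) {a a₁ a₂ s s₁ s₂ : ℝ} (ha : 0 ≤ a)
    (ha₁ : 0 ≤ a₁) (ha₂ : 0 ≤ a₂) (hs : 0 ≤ s) (hs₁ : 0 ≤ s₁) (hs₂ : 0 ≤ s₂)
    (h : a ^ (1 / p) ≤ a₁ ^ (1 / p) + a₂ ^ (1 / p)) (h' : s ≤ s₁ + s₂) :
    (a + s) ^ (1 / p) ≤ (a₁ + s₁) ^ (1 / p) + (a₂ + s₂) ^ (1 / p) := by
  have hp0 : 0 < p := by linarith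
  have key : ∀ {x : ℝ}, 0 ≤ x → (x ^ (1 / p)) ^ p = x := fun hx => by
    rw [← Real.rpow_mul hx, one_div_mul_cancel hp0.ne', Real.rpow_one]
  have nn : ∀ {x : ℝ}, 0 ≤ x → 0 ≤ x ^ (1 / p) := fun hx => Real.rpow_nonneg hx _
  have e1 : a ≤ (a₁ ^ (1 / p) + a₂ ^ (1 / p)) ^ p := by
    have := Real.rpow_le_rpow (nn ha) h hp0.le
    rwa [key ha] at this
  have e2 : s ≤ (s₁ ^ (1 / p) + s₂ ^ (1 / p)) ^ p := by
    -- Superadditivity of the p-th power puts the bound on `s` in the same form as the one on `a`.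
    have := Real.add_rpow_le_rpow_add (nn hs₁) (nn hs₂) hp
    rw [key hs₁, key hs₂] at this
    exact h'.trans this
  -- Minkowski in the plane for the vectors of p-th roots of `(a₁, s₁)` and `(a₂, s₂)`.
  have := Real.Lp_add_le_of_nonneg (p := p) (Finset.univ : Finset (Fin 2))
    (f := ![a₁ ^ (1 / p), s₁ ^ (1 / p)]) (g := ![a₂ ^ (1 / p), s₂ ^ (1 / p)]) hp
    (by intro i _; fin_cases i <;> simp [Real.rpow_nonneg, ha₁, hs₁])
    (by intro i _; fin_cases i <;> simp [Real.rpow_nonneg, ha₂, hs₂])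
  simp only [Fin.sum_univ_two, Matrix.cons_val_zero, Matrix.cons_val_one] at this
  rw [key ha₁, key ha₂, key hs₁, key hs₂] at this
  exact (Real.rpow_le_rpow (add_nonneg ha hs) (add_le_add e1 e2) (by positivity)).trans this

section Compose

variable {X Y Z : TrajSet N T}

/-- The weights that glue two soft assignments along the middle set. -/
def glue (W : Matrix (Option X.elems) (Option Y.elems) ℝ)
    (V : Matrix (Option Y.elems) (Option Z.elems) ℝ) :
    Option X.elems → Option Y.elems → Option Z.elems → ℝ
  | i, some j, l => W i (some j) * V (some j) l
  | some i, none, none => W (some i) none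
  | none, none, some l => V none (some l)
  | _, none, _ => 0

/-- The composition of two soft assignments. -/
def compose (W : Matrix (Option X.elems) (Option Y.elems) ℝ)
    (V : Matrix (Option Y.elems) (Option Z.elems) ℝ) :
    Matrix (Option X.elems) (Option Z.elems) ℝ
  | none, none => 0
  | i, l => ∑ j, glue W V i j l

variable {W W' : Matrix (Option X.elems) (Option Y.elems) ℝ}
  {V V' : Matrix (Option Y.elems) (Option Z.elems) ℝ}

theorem glue_nonneg (hW : IsSoftAssignment W) (hV : IsSoftAssignment V) (i : Option X.elems)
    (j : Option Y.elems) (l : Option Z.elems) : 0 ≤ glue W V i j l := by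
  rcases j with _ | j
  · rcases i with _ | i <;> rcases l with _ | l <;> simp only [glue, le_refl]
    · exact hV.nonneg _ _
    · exact hW.nonneg _ _
  · exact mul_nonneg (hW.nonneg _ _) (hV.nonneg _ _)

/-- At a trajectory j the row of `V` sums to one; at `j = none` all mass of `W (some i) none` stays
unassigned. The excluded pair is a true exception: there the sum is the mass that `V` sends from
`none` to trajectories. -/
theorem sum_glue_right (hV : IsSoftAssignment V) (i : Option X.elems) (j : Option Y.elems)
    (hij : ¬ (i = none ∧ j = none)) : ∑ l, glue W V i j l = W i j := by
  rcases j with _ | j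
  · rcases i with _ | i
    · simp at hij
    · simp [Fintype.sum_option, glue]
  · simp only [glue]
    rw [← Finset.mul_sum, hV.row_sum, mul_one]

theorem sum_glue_left (hW : IsSoftAssignment W) (j : Option Y.elems) (l : Option Z.elems)
    (hjl : ¬ (j = none ∧ l = none)) : ∑ i, glue W V i j l = V j l := by
  rcases j with _ | j
  · rcases l with _ | l
    · simp at hjl
    · simp [Fintype.sum_option, glue]
  · simp only [glue]
    rw [← Finset.sum_mul, hW.col_sum, one_mul]

theorem compose_apply (i : Option X.elems) (l : Option Z.elems) (hil : ¬ (i = none ∧ l = none)) :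
    compose W V i l = ∑ j, glue W V i j l := by
  rcases i with _ | i <;> rcases l with _ | l
  · simp at hil
  all_goals rfl

theorem compose_some_some (i : X.elems) (l : Z.elems) :
    compose W V (some i) (some l) = ∑ j : Y.elems, W (some i) (some j) * V (some j) (some l) := by
  rw [compose_apply _ _ (by simp), Fintype.sum_option]
  simp [glue]

/-- Each row or column constraint is inherited by summing the glued weights in the other order,
which first produces a marginal. -/
theorem IsSoftAssignment.compose (hW : IsSoftAssignment W) (hV : IsSoftAssignment V) :
    IsSoftAssignment (compose W V) where
  col_sum l := by
    rw [Finset.sum_congr rfl fun i _ => compose_apply i (some l) (by simp), Finset.sum_comm,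
      Finset.sum_congr rfl fun j _ => sum_glue_left hW j (some l) (by simp), hV.col_sum]
  row_sum i := by
    rw [Finset.sum_congr rfl fun l _ => compose_apply (some i) l (by simp), Finset.sum_comm,
      Finset.sum_congr rfl fun j _ => sum_glue_right hV (some i) j (by simp), hW.row_sum]
  corner := rfl
  nonneg i l := by
    by_cases h : i = none ∧ l = none
    · rw [h.1, h.2]; exact le_rfl
    · rw [compose_apply i l h]
      exact Finset.sum_nonneg fun j _ => glue_nonneg hW hV i j l

/-- Costs that vanish at the pair of unassigned indices do not see the exceptional entry of the
marginal. -/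
theorem sum_mul_glue_left (hV : IsSoftAssignment V) (a : Option X.elems → Option Y.elems → ℝ)
    (ha : a none none = 0) :
    ∑ i, ∑ j, ∑ l, a i j * glue W V i j l = ∑ i, ∑ j, a i j * W i j := by
  refine Finset.sum_congr rfl fun i _ => Finset.sum_congr rfl fun j _ => ?_
  rw [← Finset.mul_sum]
  by_cases h : i = none ∧ j = none
  · rw [h.1, h.2, ha, zero_mul, zero_mul]
  · rw [sum_glue_right hV i j h]

theorem sum_mul_glue_right (hW : IsSoftAssignment W) (a : Option Y.elems → Option Z.elems → ℝ)
    (ha : a none none = 0) :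
    ∑ i, ∑ j, ∑ l, a j l * glue W V i j l = ∑ j, ∑ l, a j l * V j l := by
  rw [Finset.sum_comm]
  refine Finset.sum_congr rfl fun j _ => ?_
  rw [Finset.sum_comm]
  refine Finset.sum_congr rfl fun l _ => ?_
  rw [← Finset.mul_sum]
  by_cases h : j = none ∧ l = none
  · rw [h.1, h.2, ha, zero_mul, zero_mul]
  · rw [sum_glue_left hW j l h]

/-- The glued weights may put mass on the corner, from middle trajectories unassigned on both sides.
`compose` discards it, at no cost since `a` vanishes there. -/
theorem sum_mul_glue_outer (a : Option X.elems → Option Z.elems → ℝ) (ha : a none none = 0) :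
    ∑ i, ∑ j, ∑ l, a i l * glue W V i j l = ∑ i, ∑ l, a i l * compose W V i l := by
  refine Finset.sum_congr rfl fun i _ => ?_
  rw [Finset.sum_comm]
  refine Finset.sum_congr rfl fun l _ => ?_
  rw [← Finset.mul_sum]
  by_cases h : i = none ∧ l = none
  · rw [h.1, h.2, ha, zero_mul, zero_mul]
  · rw [compose_apply i l h]

theorem IsSoftAssignment.sum_some_left_le (hW : IsSoftAssignment W) (j : Y.elems) :
    ∑ i : X.elems, W (some i) (some j) ≤ 1 := by
  have := hW.col_sum j
  rw [Fintype.sum_option] at this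
  linarith [hW.nonneg none (some j)]

theorem IsSoftAssignment.sum_some_right_le (hW : IsSoftAssignment W) (i : X.elems) :
    ∑ j : Y.elems, W (some i) (some j) ≤ 1 := by
  have := hW.row_sum i
  rw [Fintype.sum_option] at this
  linarith [hW.nonneg (some i) none]

/-- Write WV − W'V' = (W − W')V' + W(V − V'). The rows of V' and the columns of W, restricted to
trajectories, sum to at most one, so neither factor enlarges the variation. -/
theorem sum_abs_compose_sub_le (hW : IsSoftAssignment W) (hV' : IsSoftAssignment V') :
    ∑ i : X.elems, ∑ l : Z.elems,
        |compose W V (some i) (some l) - compose W' V' (some i) (some l)| ≤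
      (∑ i : X.elems, ∑ j : Y.elems, |W (some i) (some j) - W' (some i) (some j)|) +
        ∑ j : Y.elems, ∑ l : Z.elems, |V (some j) (some l) - V' (some j) (some l)| := by
  calc _ ≤ ∑ i : X.elems, ∑ l : Z.elems, ∑ j : Y.elems,
        (|W (some i) (some j) - W' (some i) (some j)| * V' (some j) (some l) +
          W (some i) (some j) * |V (some j) (some l) - V' (some j) (some l)|) := by
        refine Finset.sum_le_sum fun i _ => Finset.sum_le_sum fun l _ => ?_
        rw [compose_some_some, compose_some_some, ← Finset.sum_sub_distrib]
        refine (Finset.abs_sum_le_sum_abs _ _).trans (Finset.sum_le_sum fun j _ => ?_)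
        have e : W (some i) (some j) * V (some j) (some l) -
            W' (some i) (some j) * V' (some j) (some l) =
            (W (some i) (some j) - W' (some i) (some j)) * V' (some j) (some l) +
              W (some i) (some j) * (V (some j) (some l) - V' (some j) (some l)) := by ring
        rw [e]
        refine (abs_add_le _ _).trans_eq ?_
        rw [abs_mul, abs_mul, abs_of_nonneg (hV'.nonneg _ _), abs_of_nonneg (hW.nonneg _ _)]
    _ ≤ _ := by
        simp only [Finset.sum_add_distrib]
        refine add_le_add ?_ ?_
        · refine Finset.sum_le_sum fun i _ => ?_
          rw [Finset.sum_comm]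
          refine Finset.sum_le_sum fun j _ => ?_
          rw [← Finset.mul_sum]
          exact mul_le_of_le_one_right (abs_nonneg _) (hV'.sum_some_right_le j)
        · rw [Finset.sum_comm, Finset.sum_congr rfl fun l _ => Finset.sum_comm, Finset.sum_comm]
          refine Finset.sum_le_sum fun j _ => Finset.sum_le_sum fun l _ => ?_
          rw [← Finset.sum_mul]
          exact mul_le_of_le_one_left (abs_nonneg _) (hW.sum_some_left_le j)

end Compose

theorem switchCost_compose_le {X Y Z : TrajSet N T}
    {W : ℕ → Matrix (Option X.elems) (Option Y.elems) ℝ}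
    {V : ℕ → Matrix (Option Y.elems) (Option Z.elems) ℝ}
    (hW : ∀ k, IsSoftAssignment (W k)) (hV : ∀ k, IsSoftAssignment (V k)) :
    switchCost X Z (fun k => compose (W k) (V k)) ≤ switchCost X Y W + switchCost Y Z V := by
  unfold switchCost
  rw [← Finset.sum_add_distrib]
  exact Finset.sum_le_sum fun k _ => sum_abs_compose_sub_le (hW k) (hV (k + 1))

/-- Weighted Minkowski over all times and triples (i, j, l), with the glued weights and the triangle
inequality of the base distance; the three sums collapse to location costs by the marginal
identities. -/
theorem locCost_compose_le (hdb : IsMetric db) (hc : 0 < c) (hp : 1 ≤ p) {X Y Z : TrajSet N T}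
    {W : ℕ → Matrix (Option X.elems) (Option Y.elems) ℝ}
    {V : ℕ → Matrix (Option Y.elems) (Option Z.elems) ℝ}
    (hW : ∀ k, IsSoftAssignment (W k)) (hV : ∀ k, IsSoftAssignment (V k)) :
    locCost db c p X Z (fun k => compose (W k) (V k)) ^ (1 / p) ≤
      locCost db c p X Y W ^ (1 / p) + locCost db c p Y Z V ^ (1 / p) := by
  have h0 : baseDist db c p none none ^ p = 0 := Real.zero_rpow (by linarith)
  have hn : ∀ a b, 0 ≤ baseDist db c p a b := baseDist_nonneg hdb hc
  have key := weighted_minkowski (p := p)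
    (Finset.Icc 1 T ×ˢ (Finset.univ : Finset (Option X.elems × Option Y.elems × Option Z.elems)))
    (w := fun a => glue (W a.1) (V a.1) a.2.1 a.2.2.1 a.2.2.2)
    (f := fun a => baseDist db c p (optState a.1 a.2.1) (optState a.1 a.2.2.1))
    (g := fun a => baseDist db c p (optState a.1 a.2.2.1) (optState a.1 a.2.2.2))
    (h := fun a => baseDist db c p (optState a.1 a.2.1) (optState a.1 a.2.2.2)) hp
    (fun a => glue_nonneg (hW _) (hV _) _ _ _) (fun _ => hn _ _) (fun _ => hn _ _)
    (fun _ => hn _ _) (fun _ => baseDist_triangle hdb hc hp _ _ _)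
  simp only [Finset.sum_product, Fintype.sum_prod_type] at key
  refine (le_of_eq ?_).trans (key.trans_eq ?_)
  · congr 1
    exact Finset.sum_congr rfl fun k _ => (sum_mul_glue_outer
      (fun i l => baseDist db c p (optState k i) (optState k l) ^ p) h0).symm
  · congr 2
    · exact Finset.sum_congr rfl fun k _ => sum_mul_glue_left (hV k)
        (fun i j => baseDist db c p (optState k i) (optState k j) ^ p) h0
    · exact Finset.sum_congr rfl fun k _ => sum_mul_glue_right (hW k)
        (fun j l => baseDist db c p (optState k j) (optState k l) ^ p) h0

theorem lpDist_triangle (hdb : IsMetric db) (hc : 0 < c) (hγ : 0 < γ) (hp : 1 ≤ p)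
    (X Y Z : TrajSet N T) :
    lpDist db c γ p X Z ≤ lpDist db c γ p X Y + lpDist db c γ p Y Z := by
  obtain ⟨W, hW, hWe⟩ := exists_lpDist_eq (db := db) (c := c) (γ := γ) hp X Y
  obtain ⟨V, hV, hVe⟩ := exists_lpDist_eq (db := db) (c := c) (γ := γ) hp Y Z
  have hU : ∀ k, IsSoftAssignment (compose (W k) (V k)) := fun k => (hW k).compose (hV k)
  have hg : 0 ≤ γ ^ p / 2 := by positivity
  refine (lpDist_le hp hU).trans ?_
  rw [hWe, hVe, totalCost_eq, totalCost_eq, totalCost_eq]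
  refine rpow_add_le_of_subadditive hp (locCost_nonneg hdb hc hU) (locCost_nonneg hdb hc hW)
    (locCost_nonneg hdb hc hV) (mul_nonneg hg (switchCost_nonneg _))
    (mul_nonneg hg (switchCost_nonneg _)) (mul_nonneg hg (switchCost_nonneg _))
    (locCost_compose_le hdb hc hp hW hV) ?_
  rw [← mul_add]
  exact mul_le_mul_of_nonneg_left (switchCost_compose_le hW hV) hg

/-! ### The measurable structure of trajectories -/

section Sigma

variable {ι : Type*} {β : ι → Type*}

theorem measurableSet_sigma_iff [∀ i, MeasurableSpace (β i)] {s : Set (Σ i, β i)} :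
    MeasurableSet s ↔ ∀ i, MeasurableSet (Sigma.mk i ⁻¹' s) := by
  change MeasurableSet[⨅ i, MeasurableSpace.map (Sigma.mk i) _] s ↔ _
  rw [MeasurableSpace.measurableSet_iInf]
  rfl

theorem measurable_sigma_iff [∀ i, MeasurableSpace (β i)] {γ : Type*} [MeasurableSpace γ]
    {f : (Σ i, β i) → γ} : Measurable f ↔ ∀ i, Measurable fun x => f ⟨i, x⟩ :=
  ⟨fun h i _ hs => measurableSet_sigma_iff.1 (h hs) i,
    fun h _ hs => measurableSet_sigma_iff.2 fun i => h i hs⟩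

theorem measurableEmbedding_sigmaMk [∀ i, MeasurableSpace (β i)] (i : ι) :
    MeasurableEmbedding (Sigma.mk i : β i → Σ i, β i) where
  injective := sigma_mk_injective
  measurable := measurable_sigma_iff.1 measurable_id i
  measurableSet_image' := by
    intro s hs
    refine measurableSet_sigma_iff.2 fun j => ?_
    by_cases h : i = j
    · subst h
      rwa [Set.preimage_image_eq _ sigma_mk_injective]
    · rw [Set.preimage_image_sigmaMk_of_ne (Ne.symm h)]
      exact MeasurableSet.empty

/-- Identifies the σ-algebra of the disjoint union with the Borel one, so that trajectories form a
standard Borel space and can be coded by real numbers. -/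
instance borelSpace_sigma [Countable ι] [∀ i, TopologicalSpace (β i)]
    [∀ i, MeasurableSpace (β i)] [∀ i, BorelSpace (β i)] : BorelSpace (Σ i, β i) := by
  refine ⟨le_antisymm ?_ (MeasurableSpace.generateFrom_le fun s hs => ?_)⟩
  · intro s hs
    let _ : MeasurableSpace (Σ i, β i) := borel _
    have : BorelSpace (Σ i, β i) := ⟨rfl⟩
    have h : s = ⋃ i, Sigma.mk i '' (Sigma.mk i ⁻¹' s) := by
      ext ⟨i, x⟩
      simp only [Set.mem_iUnion, Set.mem_image, Set.mem_preimage]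
      constructor
      · exact fun hx => ⟨i, x, hx, rfl⟩
      · rintro ⟨j, y, hy, h⟩
        rwa [← h]
    rw [h]
    exact MeasurableSet.iUnion fun i =>
      Topology.IsOpenEmbedding.sigmaMk.measurableEmbedding.measurableSet_image'
        (measurableSet_sigma_iff.1 hs i)
  · exact measurableSet_sigma_iff.2 fun i => (isOpen_sigma_iff.1 hs i).measurableSet

end Sigma

instance : Finite (TimeSpan T) :=
  ((Set.finite_Iic (T, T)).subset fun a ha =>
    show a ≤ (T, T) from Prod.mk_le_mk.2 ⟨ha.2.1, by have := ha.1; have := ha.2.2.2; omega⟩).to_subtype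

/-- The state at time `k`, with a default value where there is none. -/
def stateOrZero (k : ℕ) (X : Trajectory N T) : State N := (stateAt X k).getD 0

/-- The set of trajectories that are present at time `k`. -/
def aliveAt (N T k : ℕ) : Set (Trajectory N T) := {X | (stateAt X k).isSome}

theorem measurable_stateOrZero (k : ℕ) : Measurable (stateOrZero (N := N) (T := T) k) := by
  refine (measurable_sigma_iff (β := fun a : TimeSpan T => Fin a.1.2 → State N)).2 fun a => ?_
  by_cases h : a.1.1 ≤ k ∧ k + 1 ≤ a.1.1 + a.1.2
  · have hk : k - a.1.1 < a.1.2 := by have := h.2; omega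
    simp only [stateOrZero, stateAt, h, and_self, dif_pos, Option.getD_some]
    exact (by fun_prop : Measurable fun x : Fin a.1.2 → State N =>
      x ⟨k - a.1.1, hk⟩)
  · simp only [stateOrZero, stateAt, h, dif_neg, not_false_eq_true, Option.getD_none]
    exact measurable_const

theorem measurableSet_aliveAt (k : ℕ) : MeasurableSet (aliveAt N T k) := by
  refine (measurableSet_sigma_iff (β := fun a : TimeSpan T => Fin a.1.2 → State N)).2 fun a => ?_
  have : Sigma.mk a ⁻¹' aliveAt N T k =
      {_x : Fin a.1.2 → State N | a.1.1 ≤ k ∧ k + 1 ≤ a.1.1 + a.1.2} := by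
    ext x
    exact stateAt_isSome_iff _ k
  rw [this]
  exact MeasurableSet.const _

/-- Splitting by which of the two trajectories are alive at time `k` reduces to `db` on genuine
states; the default state is never used where it matters. -/
theorem measurable_baseDist_stateAt
    (hdb_meas : Measurable fun q : State N × State N => db q.1 q.2) (k : ℕ) :
    Measurable fun q : Trajectory N T × Trajectory N T =>
      baseDist db c p (stateAt q.1 k) (stateAt q.2 k) := by
  classical
  have h : (fun q : Trajectory N T × Trajectory N T =>
      baseDist db c p (stateAt q.1 k) (stateAt q.2 k)) = fun q =>
      if q.1 ∈ aliveAt N T k then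
        if q.2 ∈ aliveAt N T k then min c (db (stateOrZero k q.1) (stateOrZero k q.2))
        else c / (2 : ℝ) ^ (1 / p)
      else if q.2 ∈ aliveAt N T k then c / (2 : ℝ) ^ (1 / p) else 0 := by
    funext q
    obtain h1 | ⟨a, h1⟩ := (stateAt q.1 k).eq_none_or_eq_some <;>
      obtain h2 | ⟨b, h2⟩ := (stateAt q.2 k).eq_none_or_eq_some <;>
      simp [aliveAt, stateOrZero, h1, h2, baseDist]
  rw [h]
  have h1 : MeasurableSet {q : Trajectory N T × Trajectory N T | q.1 ∈ aliveAt N T k} :=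
    measurable_fst (measurableSet_aliveAt k)
  have h2 : MeasurableSet {q : Trajectory N T × Trajectory N T | q.2 ∈ aliveAt N T k} :=
    measurable_snd (measurableSet_aliveAt k)
  refine Measurable.ite h1 (Measurable.ite h2 (measurable_const.min ?_) measurable_const)
    (Measurable.ite h2 measurable_const measurable_const)
  exact hdb_meas.comp (((measurable_stateOrZero k).comp measurable_fst).prodMk
    ((measurable_stateOrZero k).comp measurable_snd))

theorem measurable_baseDist_none (k : ℕ) :
    Measurable fun x : Trajectory N T => baseDist db c p (stateAt x k) none := by
  classical
  have h : (fun x : Trajectory N T => baseDist db c p (stateAt x k) none) = fun x =>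
      if x ∈ aliveAt N T k then c / (2 : ℝ) ^ (1 / p) else 0 := by
    funext x
    obtain h1 | ⟨a, h1⟩ := (stateAt x k).eq_none_or_eq_some <;> simp [aliveAt, h1, baseDist]
  rw [h]
  exact Measurable.ite (measurableSet_aliveAt k) measurable_const measurable_const

theorem measurable_none_baseDist (k : ℕ) :
    Measurable fun x : Trajectory N T => baseDist db c p none (stateAt x k) := by
  convert measurable_baseDist_none (N := N) (T := T) (db := db) (c := c) (p := p) k using 2 with x
  rcases stateAt x k with _ | a <;> rfl

/-! ### Measurable enumeration of finite sets of trajectories -/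

theorem measurable_ncard_inter {B : Set (Trajectory N T)} (hB : MeasurableSet B) :
    Measurable fun X : TrajSet N T => ((X.elems : Set (Trajectory N T)) ∩ B).ncard := by
  rw [measurable_iff_comap_le]
  exact le_iSup (fun B : {B : Set (Trajectory N T) // MeasurableSet B} =>
    MeasurableSpace.comap (fun X : TrajSet N T =>
      ((X.elems : Set (Trajectory N T)) ∩ B.1).ncard) ⊤) ⟨B, hB⟩

theorem measurable_trajSet {α : Type*} [MeasurableSpace α] {f : α → TrajSet N T}
    (h : ∀ B : Set (Trajectory N T), MeasurableSet B →
      Measurable fun a => (((f a).elems : Set (Trajectory N T)) ∩ B).ncard) : Measurable f := by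
  rw [measurable_iff_comap_le]
  change MeasurableSpace.comap f (⨆ B : {B : Set (Trajectory N T) // MeasurableSet B}, _) ≤ _
  rw [MeasurableSpace.comap_iSup]
  refine iSup_le fun B => ?_
  rw [MeasurableSpace.comap_comp, ← measurable_iff_comap_le]
  exact h B.1 B.2

theorem measurable_card : Measurable fun X : TrajSet N T => X.elems.card := by
  simpa using measurable_ncard_inter (N := N) (T := T) MeasurableSet.univ

/-- The finite sets of `n` trajectories. -/
def cardSet (N T n : ℕ) : Set (TrajSet N T) := {X | X.elems.card = n}

theorem measurableSet_cardSet (n : ℕ) : MeasurableSet (cardSet N T n) :=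
  measurable_card (measurableSet_singleton n)

/-- A finite set of `n` trajectories, listed in increasing order of their codes in `ℝ`. -/
theorem exists_measurable_enumeration (n : ℕ) :
    ∃ e : ∀ X : cardSet N T n, Fin n ≃ X.1.elems,
      ∀ i, Measurable fun X => (e X i : Trajectory N T) := by
  let r : Trajectory N T → ℝ := embeddingReal (Trajectory N T)
  have hr : MeasurableEmbedding r := measurableEmbedding_embeddingReal _
  let _ : LinearOrder (Trajectory N T) := LinearOrder.lift' r hr.injective
  have hlt : ∀ x y : Trajectory N T, x < y ↔ r x < r y := fun _ _ => Iff.rfl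
  refine ⟨fun X => (X.1.elems.orderIsoOfFin X.2).toEquiv, fun i => ?_⟩
  refine hr.measurable_comp_iff.1 (measurable_of_Iio fun t => ?_)
  -- The element of rank `i` (counted from 0) has code below `t` exactly when more than `i` elements
  -- do, which is a condition on a counting map.
  have hset : (r ∘ fun X : cardSet N T n =>
        (((X.1.elems.orderIsoOfFin X.2).toEquiv i : X.1.elems) : Trajectory N T)) ⁻¹' Set.Iio t =
      {X | i.1 < ((X.1.elems : Set (Trajectory N T)) ∩ r ⁻¹' Set.Iio t).ncard} := by
    ext X
    set o := X.1.elems.orderIsoOfFin X.2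
    have himg : ((X.1.elems : Set (Trajectory N T)) ∩ r ⁻¹' Set.Iio t) =
        (fun j => (o j : Trajectory N T)) '' {j | r (o j) < t} := by
      ext x
      constructor
      · rintro ⟨hx, hxt⟩
        exact ⟨o.symm ⟨x, hx⟩, by simpa using hxt, by simp⟩
      · rintro ⟨j, hj, rfl⟩
        exact ⟨(o j).2, hj⟩
    have hinj : Function.Injective fun j => (o j : Trajectory N T) :=
      Subtype.val_injective.comp o.injective
    simp only [Set.mem_preimage, Set.mem_ofPred_eq, Function.comp, Set.mem_Iio, himg]
    rw [Set.ncard_image_of_injective _ hinj]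
    have hmono : ∀ j k, j ≤ k → r (o j) ≤ r (o k) := fun j k h => o.monotone h
    constructor
    · intro h
      have : (Set.Iic i).ncard ≤ {j | r (o j) < t}.ncard :=
        Set.ncard_le_ncard fun j hj => (hmono j i hj).trans_lt h
      rw [Set.ncard_eq_toFinset_card'] at this
      simp only [Set.toFinset_Iic, Fin.card_Iic] at this
      omega
    · intro h
      by_contra hcon
      have : {j | r (o j) < t}.ncard ≤ (Set.Iio i).ncard := by
        refine Set.ncard_le_ncard fun j hj => ?_
        by_contra hij
        exact hcon ((hmono i j (not_lt.1 hij)).trans_lt hj)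
      rw [Set.ncard_eq_toFinset_card' (Set.Iio i)] at this
      simp only [Set.toFinset_Iio, Fin.card_Iio] at this
      omega
  rw [hset]
  exact ((measurable_ncard_inter (hr.measurable measurableSet_Iio)).comp
    measurable_subtype_coe) (measurableSet_Ioi (a := i.1))

/-! ### Measurability of the metric -/

section Reindex

variable {X X' Y Y' : TrajSet N T}

theorem IsSoftAssignment.submatrix {W : Matrix (Option X.elems) (Option Y.elems) ℝ}
    (hW : IsSoftAssignment W) (σ : X'.elems ≃ X.elems) (τ : Y'.elems ≃ Y.elems) :
    IsSoftAssignment (W.submatrix σ.optionCongr τ.optionCongr) where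
  col_sum j := by
    rw [← hW.col_sum (τ j), ← Equiv.sum_comp σ.optionCongr]
    rfl
  row_sum i := by
    rw [← hW.row_sum (σ i), ← Equiv.sum_comp τ.optionCongr]
    rfl
  corner := hW.corner
  nonneg _ _ := hW.nonneg _ _

/-- The value of the objective for an arbitrary time-dependent matrix `D` of costs. -/
def objective (γ p : ℝ) (X Y : TrajSet N T) (D : ℕ → Option X.elems → Option Y.elems → ℝ)
    (W : ℕ → Matrix (Option X.elems) (Option Y.elems) ℝ) : ℝ :=
  (∑ k ∈ Finset.Icc 1 T, ∑ i, ∑ j, D k i j * W k i j + γ ^ p / 2 * switchCost X Y W) ^ (1 / p)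

/-- The costs between `X` and `Y`, with indices transported along bijections. -/
def reindexedCost (db : State N → State N → ℝ) (c p : ℝ) (σ : X'.elems ≃ X.elems)
    (τ : Y'.elems ≃ Y.elems) (k : ℕ) (i : Option X'.elems) (j : Option Y'.elems) : ℝ :=
  baseDist db c p (optState k (σ.optionCongr i)) (optState k (τ.optionCongr j)) ^ p

theorem objective_reindexedCost (σ : X'.elems ≃ X.elems) (τ : Y'.elems ≃ Y.elems)
    (W : ℕ → Matrix (Option X.elems) (Option Y.elems) ℝ) :
    objective γ p X' Y' (reindexedCost db c p σ τ)
      (fun k => (W k).submatrix σ.optionCongr τ.optionCongr) =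
      totalCost db c γ p X Y W ^ (1 / p) := by
  rw [totalCost_eq, objective]
  congr 2
  · refine Finset.sum_congr rfl fun k _ => ?_
    rw [← Equiv.sum_comp σ.optionCongr]
    refine Finset.sum_congr rfl fun i _ => ?_
    rw [← Equiv.sum_comp τ.optionCongr]
    rfl
  · congr 1
    refine Finset.sum_congr rfl fun k _ => ?_
    rw [← Equiv.sum_comp σ]
    refine Finset.sum_congr rfl fun i _ => ?_
    rw [← Equiv.sum_comp τ]
    rfl

/-- Frees the domain of minimization from X and Y: only the costs vary, while the matrices are
indexed by the fixed sets X' and Y'. -/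
theorem lpDist_eq_sInf_objective (σ : X'.elems ≃ X.elems) (τ : Y'.elems ≃ Y.elems) :
    lpDist db c γ p X Y = sInf (objective γ p X' Y' (reindexedCost db c p σ τ) ''
      {W | ∀ k, IsSoftAssignment (W k)}) := by
  unfold lpDist
  congr 1
  ext r
  constructor
  · rintro ⟨W, hW, rfl⟩
    exact ⟨_, fun k => (hW k).submatrix σ τ, objective_reindexedCost σ τ W⟩
  · rintro ⟨W, hW, rfl⟩
    refine ⟨_, fun k => (hW k).submatrix σ.symm τ.symm, ?_⟩
    rw [← objective_reindexedCost σ τ]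
    congr 1
    funext k
    ext i j
    rcases i with _ | i <;> rcases j with _ | j <;> simp [-Equiv.optionCongr_symm]

end Reindex

theorem continuous_objective (hp : 0 < p) (X Y : TrajSet N T) :
    Continuous (Function.uncurry (objective γ p X Y)) := by
  unfold Function.uncurry objective switchCost
  have hW : ∀ (k : ℕ) (i : Option X.elems) (j : Option Y.elems),
      Continuous fun a : (ℕ → Option X.elems → Option Y.elems → ℝ) ×
        (ℕ → Matrix (Option X.elems) (Option Y.elems) ℝ) => a.2 k i j := fun k i j =>
    ((continuous_apply k).comp continuous_snd).matrix_elem i j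
  have hD : ∀ (k : ℕ) (i : Option X.elems) (j : Option Y.elems),
      Continuous fun a : (ℕ → Option X.elems → Option Y.elems → ℝ) ×
        (ℕ → Matrix (Option X.elems) (Option Y.elems) ℝ) => a.1 k i j := fun k i j => by
    fun_prop
  refine Continuous.rpow_const (Continuous.add ?_ (continuous_const.mul ?_))
    fun _ => Or.inr (by positivity)
  · exact continuous_finsetSum _ fun k _ => continuous_finsetSum _ fun i _ =>
      continuous_finsetSum _ fun j _ => (hD k i j).mul (hW k i j)
  · exact continuous_finsetSum _ fun k _ => continuous_finsetSum _ fun i _ =>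
      continuous_finsetSum _ fun j _ => ((hW _ _ _).sub (hW _ _ _)).abs

theorem isCompact_softAssignments (X Y : TrajSet N T) :
    IsCompact {W : ℕ → Matrix (Option X.elems) (Option Y.elems) ℝ |
      ∀ k, IsSoftAssignment (W k)} := by
  convert isCompact_univ_pi (fun _ : ℕ => isCompact_softAssignment X Y) using 1
  ext W
  exact ⟨fun h k _ => h k, fun h k => h k trivial⟩

/-- With X₀ and Y₀ as reference index sets, the infimum over the compact set of assignments is
continuous in the costs, and the costs are measurable in (X, Y) through the enumerations. -/
theorem measurable_lpDist_cardSet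
    (hdb_meas : Measurable fun q : State N × State N => db q.1 q.2) (hp : 0 < p) (n m : ℕ) :
    Measurable fun q : cardSet N T n × cardSet N T m => lpDist db c γ p q.1.1 q.2.1 := by
  rcases isEmpty_or_nonempty (cardSet N T n × cardSet N T m) with h | ⟨⟨X₀, Y₀⟩⟩
  · exact measurable_of_empty _
  obtain ⟨e, he⟩ := exists_measurable_enumeration (N := N) (T := T) n
  obtain ⟨f, hf⟩ := exists_measurable_enumeration (N := N) (T := T) m
  simp only [fun q : cardSet N T n × cardSet N T m => lpDist_eq_sInf_objective
    (db := db) (c := c) (γ := γ) (p := p)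
    ((e X₀).symm.trans (e q.1)) ((f Y₀).symm.trans (f q.2))]
  refine ((isCompact_softAssignments X₀.1 Y₀.1).continuous_sInf
    (continuous_objective hp X₀.1 Y₀.1)).measurable.comp
    (measurable_pi_lambda _ fun k => measurable_pi_lambda _ fun i =>
      measurable_pi_lambda _ fun j => Measurable.pow_const ?_ _)
  rcases i with _ | i <;> rcases j with _ | j
  · exact measurable_const
  · exact (measurable_none_baseDist k).comp ((hf _).comp measurable_snd)
  · exact (measurable_baseDist_none k).comp ((he _).comp measurable_fst)
  · exact (measurable_baseDist_stateAt hdb_meas k).comp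
      (((he _).comp measurable_fst).prodMk ((hf _).comp measurable_snd))

theorem measurable_lpDist
    (hdb_meas : Measurable fun q : State N × State N => db q.1 q.2) (hp : 0 < p) :
    Measurable fun q : TrajSet N T × TrajSet N T => lpDist db c γ p q.1 q.2 := by
  intro s hs
  have h : (fun q : TrajSet N T × TrajSet N T => lpDist db c γ p q.1 q.2) ⁻¹' s =
      ⋃ n, ⋃ m, Prod.map (Subtype.val : cardSet N T n → _) (Subtype.val : cardSet N T m → _) ''
        ((fun q : cardSet N T n × cardSet N T m => lpDist db c γ p q.1.1 q.2.1) ⁻¹' s) := by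
    ext ⟨X, Y⟩
    simp only [Set.mem_iUnion]
    constructor
    · exact fun h => ⟨_, _, (⟨X, rfl⟩, ⟨Y, rfl⟩), h, rfl⟩
    · rintro ⟨n, m, q, hq, he⟩
      rw [← he]
      exact hq
  rw [h]
  exact MeasurableSet.iUnion fun n => MeasurableSet.iUnion fun m =>
    ((MeasurableEmbedding.subtype_coe (measurableSet_cardSet n)).prodMap
      (MeasurableEmbedding.subtype_coe (measurableSet_cardSet m))).measurableSet_image'
      (measurable_lpDist_cardSet hdb_meas hp n m hs)

/-! ### The set integral as an integral -/

open scoped Classical in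
/-- The set of the entries of a tuple of trajectories. -/
def ofTuple {n : ℕ} (x : Fin n → Trajectory N T) : TrajSet N T := ⟨Finset.univ.image x⟩

theorem measurable_ofTuple (n : ℕ) :
    Measurable (ofTuple : (Fin n → Trajectory N T) → TrajSet N T) := by
  classical
  refine measurable_trajSet fun B hB => ?_
  -- A tuple may have repetitions, so the elements of its image in `B` are counted by their first
  -- occurrences.
  have h : (fun x : Fin n → Trajectory N T =>
      (((ofTuple x).elems : Set (Trajectory N T)) ∩ B).ncard) = fun x =>
      ∑ i, if x i ∈ B ∧ ∀ j, j < i → x j ≠ x i then 1 else 0 := by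
    funext x
    rw [← Finset.card_filter]
    have himg : (((ofTuple x).elems : Set (Trajectory N T)) ∩ B) =
        ((Finset.univ.filter fun i => x i ∈ B ∧ ∀ j, j < i → x j ≠ x i).image x :
          Finset (Trajectory N T)) := by
      ext y
      simp only [ofTuple, Finset.coe_image, Finset.coe_univ, Set.image_univ, Set.mem_inter_iff,
        Set.mem_range, Finset.coe_filter, Finset.mem_univ, true_and, Set.mem_image,
        Set.mem_ofPred_eq]
      constructor
      · rintro ⟨hy, hyB⟩
        have hne : (Finset.univ.filter fun i => x i = y).Nonempty := by
          obtain ⟨i, hi⟩ := hy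
          exact ⟨i, by simp [hi]⟩
        have hmin := Finset.min'_mem _ hne
        set i := (Finset.univ.filter fun i => x i = y).min' hne with hi
        have hxi : x i = y := by simpa using hmin
        refine ⟨i, ⟨by rwa [hxi], fun j hj hji => ?_⟩, hxi⟩
        exact absurd (Finset.min'_le _ j (by simp [hji, hxi])) (not_le.2 hj)
      · rintro ⟨i, ⟨hi, _⟩, rfl⟩
        exact ⟨⟨i, rfl⟩, hi⟩
    rw [himg, Set.ncard_coe_finset, Finset.card_image_of_injOn]
    intro i hi j hj hij
    simp only [Finset.coe_filter, Finset.mem_univ, true_and, Set.mem_ofPred_eq] at hi hj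
    rcases lt_trichotomy i j with hlt | heq | hlt
    · exact absurd hij (hj.2 i hlt)
    · exact heq
    · exact absurd hij.symm (hi.2 j hlt)
  rw [h]
  refine Finset.measurable_sum _ fun i _ => Measurable.ite ?_ measurable_const measurable_const
  have h' : {x : Fin n → Trajectory N T | x i ∈ B ∧ ∀ j, j < i → x j ≠ x i} =
      {x | x i ∈ B} ∩ ⋂ j, ⋂ _ : j < i, {x | x j = x i}ᶜ := by
    ext x
    simp
  rw [h']
  refine MeasurableSet.inter (measurable_pi_apply i hB)
    (MeasurableSet.iInter fun j => MeasurableSet.iInter fun _ => MeasurableSet.compl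
    (measurableSet_eq_fun (measurable_pi_apply j) (measurable_pi_apply i)))

/-- There are only finitely many pairs of start time and length, and Lebesgue measure is σ-finite on
each piece. -/
instance : SigmaFinite (trajMeasure N T) := by
  have : ∀ a : TimeSpan T,
      SigmaFinite ((volume : Measure (Fin a.1.2 → State N)).map (Sigma.mk a)) :=
    fun a => (measurableEmbedding_sigmaMk
      (β := fun a : TimeSpan T => Fin a.1.2 → State N) a).sigmaFinite_map
  unfold trajMeasure
  infer_instance

/-- The measure on finite sets of trajectories behind the set integral. -/
def setMeasure (N T : ℕ) : Measure (TrajSet N T) :=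
  Measure.sum fun n : ℕ => ((n.factorial : ℝ≥0∞))⁻¹ •
    (Measure.pi fun _ : Fin n => trajMeasure N T).map ofTuple

instance : SFinite (setMeasure N T) := by
  unfold setMeasure
  infer_instance

theorem setIntegral_eq_lintegral {f : TrajSet N T → ℝ≥0∞} (hf : Measurable f) :
    setIntegral f = ∫⁻ X, f X ∂setMeasure N T := by
  rw [setMeasure, lintegral_sum_measure, setIntegral]
  refine tsum_congr fun n => ?_
  rw [lintegral_smul_measure, lintegral_map hf (measurable_ofTuple n), smul_eq_mul]
  rfl

/-- Tonelli's theorem, for which s-finiteness of `setMeasure` is enough. -/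
theorem setIntegral_setIntegral_eq_lintegral {f : TrajSet N T × TrajSet N T → ℝ≥0∞}
    (hf : Measurable f) :
    (setIntegral fun y => setIntegral fun x => f (x, y)) =
      ∫⁻ q, f q ∂(setMeasure N T).prod (setMeasure N T) := by
  have h : (fun y => setIntegral fun x => f (x, y)) =
      fun y => ∫⁻ x, f (x, y) ∂setMeasure N T := by
    funext y
    exact setIntegral_eq_lintegral (hf.comp (measurable_id.prodMk measurable_const))
  rw [h, setIntegral_eq_lintegral hf.lintegral_prod_left', lintegral_prod_symm' _ hf]

section Random

variable {Ω : Type*} [MeasurableSpace Ω] {P : Measure Ω}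

theorem measurable_pair (X Y : RandomTrajSet N T P) : Measurable fun ω => (X ω, Y ω) :=
  X.measurable_toFun.prodMk Y.measurable_toFun

/-- The density condition on events says that two measures agree on all measurable sets; integrals
of general functions follow from this. -/
theorem IsJointDensity.map_eq {X Y : RandomTrajSet N T P} {ψ : TrajSet N T × TrajSet N T → ℝ≥0∞}
    (h : IsJointDensity X Y ψ) :
    P.map (fun ω => (X ω, Y ω)) = ((setMeasure N T).prod (setMeasure N T)).withDensity ψ := by
  refine Measure.ext fun A hA => ?_
  rw [Measure.map_apply (measurable_pair X Y) hA, withDensity_apply _ hA,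
    ← lintegral_indicator hA,
    ← setIntegral_setIntegral_eq_lintegral (h.measurable.indicator hA)]
  exact h.prob_eq A hA

theorem IsJointDensity.lintegral_eq {X Y : RandomTrajSet N T P}
    {ψ : TrajSet N T × TrajSet N T → ℝ≥0∞} (h : IsJointDensity X Y ψ)
    {f : TrajSet N T × TrajSet N T → ℝ≥0∞} (hf : Measurable f) :
    ∫⁻ ω, f (X ω, Y ω) ∂P =
      setIntegral fun y => setIntegral fun x => f (x, y) * ψ (x, y) := by
  rw [← lintegral_map hf (measurable_pair X Y), h.map_eq,
    lintegral_withDensity_eq_lintegral_mul _ h.measurable hf,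
    ← setIntegral_setIntegral_eq_lintegral (h.measurable.mul hf)]
  simp only [Pi.mul_apply, mul_comm]

/-! ### The metric on random finite sets -/

theorem measurable_lpDist_random
    (hdb_meas : Measurable fun q : State N × State N => db q.1 q.2) (hp : 1 ≤ p)
    (X Y : RandomTrajSet N T P) :
    Measurable fun ω => lpDist db c γ p (X ω) (Y ω) := by
  have hp0 : 0 < p := by linarith
  exact Measurable.comp (g := fun q : TrajSet N T × TrajSet N T => lpDist db c γ p q.1 q.2)
    (f := fun ω => (X ω, Y ω)) (measurable_lpDist hdb_meas hp0) (measurable_pair X Y)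

theorem meanDist_eq_zero_iff (hdb : IsMetric db)
    (hdb_meas : Measurable fun q : State N × State N => db q.1 q.2) (hc : 0 < c) (hγ : 0 < γ)
    (hp : 1 ≤ p) (X Y : RandomTrajSet N T P) :
    meanDist db c γ p X Y = 0 ↔ ∀ᵐ ω ∂P, X ω = Y ω := by
  have hp0 : 0 < p := by linarith
  rw [meanDist, ENNReal.rpow_eq_zero_iff_of_pos (by positivity), lintegral_eq_zero_iff
    ((measurable_lpDist_random hdb_meas hp X Y).pow_const p).ennreal_ofReal]
  refine Filter.eventually_congr (Filter.Eventually.of_forall fun ω => ?_)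
  have hn := lpDist_nonneg (p := p) hdb hc hγ (X ω) (Y ω)
  rw [← lpDist_eq_zero_iff hdb hc hγ hp, Pi.zero_apply, ENNReal.ofReal_eq_zero,
    ← Real.rpow_eq_zero hn hp0.ne']
  exact ⟨fun h => h.antisymm (Real.rpow_nonneg hn _), fun h => h.le⟩

theorem meanDist_comm (hdb : IsMetric db) (hp : 1 ≤ p) (X Y : RandomTrajSet N T P) :
    meanDist db c γ p X Y = meanDist db c γ p Y X := by
  simp only [meanDist, lpDist_comm hdb hp]

/-- The pointwise triangle inequality followed by Minkowski's inequality in L^p(P). -/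
theorem meanDist_triangle (hdb : IsMetric db)
    (hdb_meas : Measurable fun q : State N × State N => db q.1 q.2) (hc : 0 < c) (hγ : 0 < γ)
    (hp : 1 ≤ p) (X Y Z : RandomTrajSet N T P) :
    meanDist db c γ p X Z ≤ meanDist db c γ p X Y + meanDist db c γ p Y Z := by
  have hp0 : 0 < p := by linarith
  have hn := lpDist_nonneg (p := p) (T := T) hdb hc hγ
  simp only [meanDist, ← fun X Y => ENNReal.ofReal_rpow_of_nonneg (hn X Y) hp0.le]
  refine le_trans ?_ (ENNReal.lintegral_Lp_add_le
    (measurable_lpDist_random hdb_meas hp X Y).ennreal_ofReal.aemeasurable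
    (measurable_lpDist_random hdb_meas hp Y Z).ennreal_ofReal.aemeasurable hp)
  refine ENNReal.rpow_le_rpow (lintegral_mono fun ω => ENNReal.rpow_le_rpow ?_ hp0.le)
    (by positivity)
  rw [Pi.add_apply, ← ENNReal.ofReal_add (hn _ _) (hn _ _)]
  exact ENNReal.ofReal_le_ofReal (lpDist_triangle hdb hc hγ hp _ _ _)

theorem integrable_lpDist_rpow (hdb : IsMetric db)
    (hdb_meas : Measurable fun q : State N × State N => db q.1 q.2) (hc : 0 < c) (hγ : 0 < γ)
    (hp : 1 ≤ p) {X Y : RandomTrajSet N T P} (hX : HasFiniteMean X) (hY : HasFiniteMean Y) :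
    Integrable (fun ω => lpDist db c γ p (X ω) (Y ω) ^ p) P := by
  have hcard : ∀ {X : RandomTrajSet N T P}, HasFiniteMean X →
      Integrable (fun ω => ((X ω).elems.card : ℝ)) P := fun {X} h => by
    refine ⟨(measurable_from_top.comp
      (measurable_card.comp X.measurable_toFun)).aestronglyMeasurable, ?_⟩
    rw [hasFiniteIntegral_iff_ofReal (Filter.Eventually.of_forall fun _ => Nat.cast_nonneg _)]
    simpa only [ENNReal.ofReal_natCast, HasFiniteMean] using h
  refine (((hcard hX).add (hcard hY)).const_mul (T * (c / (2 : ℝ) ^ (1 / p)) ^ p)).mono'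
    ((measurable_lpDist_random hdb_meas hp X Y).pow_const p).aestronglyMeasurable
    (Filter.Eventually.of_forall fun ω => ?_)
  rw [Real.norm_of_nonneg (Real.rpow_nonneg (lpDist_nonneg hdb hc hγ _ _) _)]
  exact lpDist_rpow_le_card hdb hc hγ hp _ _

theorem meanDist_lt_top (hdb : IsMetric db)
    (hdb_meas : Measurable fun q : State N × State N => db q.1 q.2) (hc : 0 < c) (hγ : 0 < γ)
    (hp : 1 ≤ p) {X Y : RandomTrajSet N T P} (hX : HasFiniteMean X) (hY : HasFiniteMean Y) :
    meanDist db c γ p X Y < ∞ := by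
  have h := (integrable_lpDist_rpow hdb hdb_meas hc hγ hp hX hY).2
  rw [hasFiniteIntegral_iff_ofReal (Filter.Eventually.of_forall fun _ =>
    Real.rpow_nonneg (lpDist_nonneg hdb hc hγ _ _) _)] at h
  exact ENNReal.rpow_lt_top_of_nonneg (one_div_nonneg.2 (by linarith)) h.ne

theorem toReal_meanDist (hdb : IsMetric db)
    (hdb_meas : Measurable fun q : State N × State N => db q.1 q.2) (hc : 0 < c) (hγ : 0 < γ)
    (hp : 1 ≤ p) (X Y : RandomTrajSet N T P) :
    (meanDist db c γ p X Y).toReal = (∫ ω, lpDist db c γ p (X ω) (Y ω) ^ p ∂P) ^ (1 / p) := by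
  rw [meanDist, ← ENNReal.toReal_rpow, integral_eq_lintegral_of_nonneg_ae
    (Filter.Eventually.of_forall fun _ => Real.rpow_nonneg (lpDist_nonneg hdb hc hγ _ _) _)
    ((measurable_lpDist_random hdb_meas hp X Y).pow_const p).aestronglyMeasurable]

/-- The metric space of random finite sets of trajectories with finite expected cardinality. -/
abbrev randomTrajMetricSpace (hdb : IsMetric db)
    (hdb_meas : Measurable fun q : State N × State N => db q.1 q.2) (hc : 0 < c) (hγ : 0 < γ)
    (hp : 1 ≤ p) (P : Measure Ω) : MetricSpace (RandomTrajSpace N T P) where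
  dist := Quotient.lift₂ (fun X Y => (meanDist db c γ p X.1 Y.1).toReal) (by
    intro X Y X' Y' h h'
    have hX : ∀ᵐ ω ∂P, X.1 ω = X'.1 ω := h
    have hY : ∀ᵐ ω ∂P, Y.1 ω = Y'.1 ω := h'
    simp only [meanDist]
    congr 2
    refine lintegral_congr_ae ?_
    filter_upwards [hX, hY] with ω h1 h2
    rw [h1, h2])
  dist_self x := by
    induction x using Quotient.inductionOn with | _ X
    change (meanDist db c γ p X.1 X.1).toReal = 0
    rw [(meanDist_eq_zero_iff hdb hdb_meas hc hγ hp X.1 X.1).2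
      (Filter.Eventually.of_forall fun _ => rfl), ENNReal.toReal_zero]
  dist_comm x y := by
    induction x, y using Quotient.inductionOn₂ with | _ X Y
    change (meanDist db c γ p X.1 Y.1).toReal = (meanDist db c γ p Y.1 X.1).toReal
    rw [meanDist_comm hdb hp]
  dist_triangle x y z := by
    induction x, y, z using Quotient.inductionOn₃ with | _ X Y Z
    change (meanDist db c γ p X.1 Z.1).toReal ≤
      (meanDist db c γ p X.1 Y.1).toReal + (meanDist db c γ p Y.1 Z.1).toReal
    -- `toReal` sends ∞ to 0, so the inequality passes to real numbers only because the distances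
    -- are finite.
    have h1 := (meanDist_lt_top hdb hdb_meas hc hγ hp X.2 Y.2).ne
    have h2 := (meanDist_lt_top hdb hdb_meas hc hγ hp Y.2 Z.2).ne
    rw [← ENNReal.toReal_add h1 h2]
    exact ENNReal.toReal_mono (ENNReal.add_ne_top.2 ⟨h1, h2⟩)
      (meanDist_triangle hdb hdb_meas hc hγ hp _ _ _)
  eq_of_dist_eq_zero {x y} h := by
    induction x, y using Quotient.inductionOn₂ with | _ X Y
    refine Quotient.sound ((meanDist_eq_zero_iff hdb hdb_meas hc hγ hp X.1 Y.1).1 ?_)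
    exact ((ENNReal.toReal_eq_zero_iff _).1 h).resolve_right
      (meanDist_lt_top hdb hdb_meas hc hγ hp X.2 Y.2).ne

end Random

end TrajectoryMetric

end

theorem mainTheorem3 (N T : ℕ)
    (db : TrajectoryMetric.State N → TrajectoryMetric.State N → ℝ)
    (hdb : TrajectoryMetric.IsMetric db)
    (hdb_meas : Measurable fun q : TrajectoryMetric.State N × TrajectoryMetric.State N =>
      db q.1 q.2)
    (c γ p : ℝ) (hc : 0 < c) (hγ : 0 < γ) (hp : 1 ≤ p)
    {Ω : Type*} [MeasurableSpace Ω] (P : Measure Ω) [IsProbabilityMeasure P] :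
    -- the random variable whose moment is taken is measurable
    (∀ X Y : TrajectoryMetric.RandomTrajSet N T P,
      Measurable fun ω => TrajectoryMetric.lpDist db c γ p (X ω) (Y ω)) ∧
    -- on all random finite sets, it has the properties of a metric with values in `[0, ∞]`
    (∀ X Y : TrajectoryMetric.RandomTrajSet N T P,
      TrajectoryMetric.meanDist db c γ p X Y = 0 ↔ ∀ᵐ ω ∂P, X ω = Y ω) ∧
    (∀ X Y : TrajectoryMetric.RandomTrajSet N T P,
      TrajectoryMetric.meanDist db c γ p X Y = TrajectoryMetric.meanDist db c γ p Y X) ∧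
    (∀ X Y Z : TrajectoryMetric.RandomTrajSet N T P,
      TrajectoryMetric.meanDist db c γ p X Z ≤
        TrajectoryMetric.meanDist db c γ p X Y + TrajectoryMetric.meanDist db c γ p Y Z) ∧
    -- on random finite sets with finite expected cardinality, it is a finite metric
    (∃ _ : MetricSpace (TrajectoryMetric.RandomTrajSpace N T P),
      ∀ (X Y : TrajectoryMetric.RandomTrajSet N T P)
        (hX : TrajectoryMetric.HasFiniteMean X) (hY : TrajectoryMetric.HasFiniteMean Y),
        Integrable (fun ω => TrajectoryMetric.lpDist db c γ p (X ω) (Y ω) ^ p) P ∧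
        dist (TrajectoryMetric.RandomTrajSpace.mk X hX) (TrajectoryMetric.RandomTrajSpace.mk Y hY) =
          (∫ ω, TrajectoryMetric.lpDist db c γ p (X ω) (Y ω) ^ p ∂P) ^ (1 / p)) ∧
    -- in terms of a joint density, the expectation is a double set integral
    (∀ (X Y : TrajectoryMetric.RandomTrajSet N T P)
      (ψ : TrajectoryMetric.TrajSet N T × TrajectoryMetric.TrajSet N T → ℝ≥0∞),
      TrajectoryMetric.IsJointDensity X Y ψ →
        TrajectoryMetric.meanDist db c γ p X Y =
          (TrajectoryMetric.setIntegral fun y => TrajectoryMetric.setIntegral fun x =>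
            ENNReal.ofReal (TrajectoryMetric.lpDist db c γ p x y ^ p) * ψ (x, y)) ^ (1 / p)) := by
  have hp0 : 0 < p := by linarith
  refine ⟨fun X Y => TrajectoryMetric.measurable_lpDist_random hdb_meas hp X Y,
    fun X Y => TrajectoryMetric.meanDist_eq_zero_iff hdb hdb_meas hc hγ hp X Y,
    fun X Y => TrajectoryMetric.meanDist_comm hdb hp X Y,
    fun X Y Z => TrajectoryMetric.meanDist_triangle hdb hdb_meas hc hγ hp X Y Z,
    ⟨TrajectoryMetric.randomTrajMetricSpace hdb hdb_meas hc hγ hp P, fun X Y hX hY =>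
      ⟨TrajectoryMetric.integrable_lpDist_rpow hdb hdb_meas hc hγ hp hX hY,
        TrajectoryMetric.toReal_meanDist hdb hdb_meas hc hγ hp X Y⟩⟩, fun X Y ψ h => ?_⟩
  rw [TrajectoryMetric.meanDist]
  congr 1
  exact h.lintegral_eq (f := fun q => ENNReal.ofReal (TrajectoryMetric.lpDist db c γ p q.1 q.2 ^ p))
    ((TrajectoryMetric.measurable_lpDist hdb_meas hp0).pow_const p).ennreal_ofReal
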